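/- Let $V\colon\mathbb R\to\mathbb R$ be bounded, and for $E\in\mathbb R$ put $J(E)=\{x\in\mathbb R: V(x)>E\}$. Assume: (H1) $V\in C^1(\mathbb R)$ has a local minimum at $x_0$ with value $v_0=V(x_0)$, $\overline{J(v_0)}$ is connected, and $\limsup_{|x|\to\infty}V(x)<v_0$. Fix $\omega_-<0<\omega_+$ with $[\omega_-,\omega_+]\setminus\{x_0\}\subset J(v_0)$. (H4) $V\in C^3(\mathbb R)$; $V(x)<v_0$ for every $x\notin[\omega_-,\omega_+]\cup\overline{J(v_0)}$; and there are constants $\varepsilon>0$ and $v_\pm<v_0$ such that, as $x\to\pm\infty$, $V(x)-v_\pm=O(|x|^{-\varepsilon})$ and $V^{(n)}(x)=O(|x|^{-\varepsilon-1})$ for $n=1,2$. For $\hbar>0$ and large $\ell$, let $H^e_-(\ell)$ and $H^e_+(\ell)$ be the operators $-\hbar^2\frac{d^2}{dx^2}+V$ in $L^2((-\ell,\omega_-))$ and $L^2((\omega_+,\ell))$, respectively, with Dirichlet boundary conditions, i.e. with domain $H^1_0\cap H^2$ of the interval. The quantum number of an eigenvalue $E$ of one of these operators is the number $m\in\{0,1,2,\dots\}$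 of its eigenvalues that are strictly smaller than $E$. Let $0<\kappa\le\min\{\varepsilon,1\}$, with $\kappa<1$ in case $\varepsilon=1$ (so $\kappa=\varepsilon$ is allowed if $\varepsilon<1$, and $\kappa=1$ if $\varepsilon>1$). Then there are $\delta,\hbar_0,\ell_0,C>0$ (depending only on $V$, $x_0$, $\omega_\pm$, $\varepsilon$, $\kappa$) such that for all $\hbar\in(0,\hbar_0)$, all $\ell>\ell_0$ and both signs $\alpha\in\{-,+\}$, every eigenvalue $E\in(v_0,v_0+\delta)$ of $H^e_\alpha(\ell)$ has a (finite) quantum number $m$, and $$E=v_\alpha+\Bigl(\bigl(m+\tfrac34\bigr)\frac{\pi\hbar}{\ell}\Bigr)^2(1+r)\qquad\text{with}\quad |r|\le C\,(\hbar+\ell^{-\kappa}),$$ that is, $E=v_\alpha+\bigl((m+\frac34)\frac{\pi\hbar}{\ell}\bigr)^2\bigl(1+O(\hbar)+O(\ell^{-\kappa})\bigr)$ uniformly in $E$ and $m$ as $\hbar\to0$ and $\ell\to\infty$. -/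

import Mathlib

open Filter MeasureTheory Topology Asymptotics

namespace BoxResonance

/-- The classically forbidden region `J(E) = {x : V x > E}`. -/
def forbiddenRegion (V : ℝ → ℝ) (E : ℝ) : Set ℝ := {x | E < V x}

/-- Hypothesis (H1): `V` is bounded and `C¹`, has a local minimum at `x₀` with value `v₀`, the
closure of `J(v₀)` is connected, and `limsup_{|x| → ∞} V x < v₀`. (The limit superior is not a
junk value, since `V` is bounded.) -/
structure HypothesisH1 (V : ℝ → ℝ) (x₀ v₀ : ℝ) : Prop where
  contDiff : ContDiff ℝ 1 V
  bounded : ∃ M : ℝ, ∀ x, |V x| ≤ M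
  value : V x₀ = v₀
  localMin : IsLocalMin V x₀
  connected : IsConnected (closure (forbiddenRegion V v₀))
  limsup_lt : limsup V (cocompact ℝ) < v₀

/-- The interior region is `(ωm, ωp)` with `ωm < 0 < ωp`, and `V > v₀` on its closure except at
`x₀`. -/
structure IsInteriorRegion (V : ℝ → ℝ) (x₀ v₀ ωm ωp : ℝ) : Prop where
  neg : ωm < 0
  pos : 0 < ωp
  subset : Set.Icc ωm ωp \ {x₀} ⊆ forbiddenRegion V v₀

/-- Hypothesis (H4), with limits `vm`, `vp` of `V` at `-∞`, `+∞` and decay exponent `ε`. -/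
structure HypothesisH4 (V : ℝ → ℝ) (v₀ ωm ωp vm vp ε : ℝ) : Prop where
  contDiff : ContDiff ℝ 3 V
  eps_pos : 0 < ε
  exterior_lt : ∀ x ∈ (Set.Icc ωm ωp)ᶜ \ closure (forbiddenRegion V v₀), V x < v₀
  vm_lt : vm < v₀
  vp_lt : vp < v₀
  decay_bot : (fun x : ℝ => V x - vm) =O[atBot] fun x : ℝ => |x| ^ (-ε)
  decay_top : (fun x : ℝ => V x - vp) =O[atTop] fun x : ℝ => |x| ^ (-ε)
  deriv_bot : ∀ n : ℕ, n = 1 ∨ n = 2 →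
    iteratedDeriv n V =O[atBot] fun x : ℝ => |x| ^ (-ε - 1)
  deriv_top : ∀ n : ℕ, n = 1 ∨ n = 2 →
    iteratedDeriv n V =O[atTop] fun x : ℝ => |x| ^ (-ε - 1)

/-- Test functions `C_c^∞(Ω)`. -/
def IsTestFunction (Ω : Set ℝ) (φ : ℝ → ℂ) : Prop :=
  ContDiff ℝ ((⊤ : ℕ∞) : WithTop ℕ∞) φ ∧ HasCompactSupport φ ∧ tsupport φ ⊆ Ω

/-- `u ∈ L²(Ω)`. -/
def MemL2 (Ω : Set ℝ) (u : ℝ → ℂ) : Prop := MemLp u 2 (volume.restrict Ω)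

/-- `v` is the weak derivative of `u` on `Ω`. -/
def IsWeakDeriv (Ω : Set ℝ) (u v : ℝ → ℂ) : Prop :=
  ∀ φ : ℝ → ℂ, IsTestFunction Ω φ →
    ∫ x in Ω, u x * deriv φ x = - ∫ x in Ω, v x * φ x

/-- `u ∈ H²(Ω)`, with weak derivatives `u₁ = u'` and `u₂ = u''`. -/
structure IsSobolevH2 (Ω : Set ℝ) (u u₁ u₂ : ℝ → ℂ) : Prop where
  memL2 : MemL2 Ω u
  memL2_deriv : MemL2 Ω u₁
  memL2_deriv2 : MemL2 Ω u₂
  weakDeriv : IsWeakDeriv Ω u u₁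
  weakDeriv2 : IsWeakDeriv Ω u₁ u₂

/-- `u ∈ H¹₀(Ω)`, with weak derivative `u₁`: the pair `(u, u₁)` is the limit in `L²(Ω) × L²(Ω)` of
pairs `(φ, φ')` of test functions and their derivatives. -/
structure IsSobolevH10 (Ω : Set ℝ) (u u₁ : ℝ → ℂ) : Prop where
  memL2 : MemL2 Ω u
  memL2_deriv : MemL2 Ω u₁
  approx : ∃ φ : ℕ → ℝ → ℂ, (∀ n, IsTestFunction Ω (φ n)) ∧
    Tendsto (fun n => eLpNorm (φ n - u) 2 (volume.restrict Ω)) atTop (𝓝 0) ∧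
    Tendsto (fun n => eLpNorm (deriv (φ n) - u₁) 2 (volume.restrict Ω)) atTop (𝓝 0)

/-- `E` is an eigenvalue of the Dirichlet operator `-ħ² d²/dx² + V` in `L²(Ω)` with domain
`H¹₀(Ω) ∩ H²(Ω)`. -/
def IsDirichletEigenvalue (ħ : ℝ) (V : ℝ → ℝ) (Ω : Set ℝ) (E : ℝ) : Prop :=
  ∃ u u₁ u₂ : ℝ → ℂ, IsSobolevH2 Ω u u₁ u₂ ∧ IsSobolevH10 Ω u u₁ ∧
    (¬ ∀ᵐ x ∂(volume.restrict Ω), u x = 0) ∧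
    ∀ᵐ x ∂(volume.restrict Ω), -(ħ : ℂ) ^ 2 * u₂ x + (V x : ℂ) * u x = (E : ℂ) * u x

/-- The exterior region `(-ℓ, ωm)` in the box, on which `H^e_-(ℓ)` acts. -/
def exteriorMinus (ωm ℓ : ℝ) : Set ℝ := Set.Ioo (-ℓ) ωm

/-- The exterior region `(ωp, ℓ)` in the box, on which `H^e_+(ℓ)` acts. -/
def exteriorPlus (ωp ℓ : ℝ) : Set ℝ := Set.Ioo ωp ℓ

/-- `m` is the quantum number of the level `E`: exactly `m` eigenvalues lie strictly below `E`.
The eigenvalues are simple, so this is the place of `E` in the increasing enumeration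
`E₀ < E₁ < …`. -/
def IsQuantumNumber (ħ : ℝ) (V : ℝ → ℝ) (Ω : Set ℝ) (E : ℝ) (m : ℕ) : Prop :=
  {E' : ℝ | IsDirichletEigenvalue ħ V Ω E' ∧ E' < E}.encard = m

end BoxResonance

/-! Write `u = R sin θ`, `u' = s R cos θ` for the solution of `-u'' + (V/ħ²) u = (E/ħ²) u` that
vanishes at the left end. The phase satisfies a first-order equation of its own, and `E` is a
Dirichlet eigenvalue exactly when `θ b ∈ πℤ`. Since `θ b` is positive, continuous and strictly
increasing in `E`, and at most `π/2` for very low `E`, it equals `(m+1)π` at the eigenvalue with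
quantum number `m` (`exists_isQuantumNumber`).

With `k = √(E - v)` and the scale `s = k/ħ`, the phase equation is `θ' = s` up to a term bounded by
`|V - v|/(ħ k)`. Integration gives `(m+1)πħ = k(b-a) + O(∫|V-v|)`, the implied constant being `1/k`
(`exists_isQuantumNumber_abs_sub_le`), and the decay of `V - v` makes the integral `O(ℓ^(1-κ))`
(`exists_integral_abs_le_rpow`). Because `E > v₀ > v` keeps `k` away from `0`, division by `ℓ` and
squaring give the claim. The constant `3/4` is the Bohr–Sommerfeld value for one turning point and
one hard wall; at this precision the change from `m+1` to `m+3/4` only costs `πħ/(4ℓ)`.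

The rest is the passage between weak `H¹₀ ∩ H²` eigenfunctions and classical solutions. -/

namespace BoxResonance

/-! ### The Prüfer phase equation and its dependence on the spectral parameter -/

section

/-- A phase `θ` with `θ a = 0` for `-u'' + W u = μ u` on `[a, b]`, in the polar coordinates
`u = R sin θ`, `u' = s R cos θ`. -/
structure IsPruferAngle (W : ℝ → ℝ) (s μ a b : ℝ) (θ : ℝ → ℝ) : Prop where
  continuous : Continuous θ
  init : θ a = 0
  hasDerivAt : ∀ x ∈ Set.Icc a b,
    HasDerivAt θ (s + ((μ - W x) / s - s) * Real.sin (θ x) ^ 2) x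

/-- As `sinc` is continuous, this factorization turns the nonlinear phase equation into a linear one
with continuous coefficient, to which the integrating-factor comparison applies. -/
theorem sin_eq_sinc_mul (x : ℝ) : Real.sin x = Real.sinc x * x := by
  rcases eq_or_ne x 0 with rfl | hx
  · simp
  · rw [Real.sinc_of_ne_zero hx, div_mul_cancel₀ _ hx]

theorem sin_sq_sub_sin_sq (x y : ℝ) :
    Real.sin x ^ 2 - Real.sin y ^ 2 = Real.sin (x - y) * Real.sin (x + y) := by
  rw [Real.sin_sub, Real.sin_add]
  nlinarith [Real.sin_sq_add_cos_sq x, Real.sin_sq_add_cos_sq y]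

theorem mul_le_of_le_of_factor_le_one {x y z : ℝ} (h : x ≤ z) (hx : 0 ≤ x) (hy : y ≤ 1) :
    x * y ≤ z :=
  (mul_le_of_le_one_right hx hy).trans h

theorem abs_sin_sq_sub_sin_sq_le (x y : ℝ) :
    |Real.sin x ^ 2 - Real.sin y ^ 2| ≤ |x - y| := by
  rw [sin_sq_sub_sin_sq, abs_mul]
  exact mul_le_of_le_of_factor_le_one (Real.abs_sin_le_abs) (abs_nonneg _) (Real.abs_sin_le_one _)

section LinearComparison

variable {a b : ℝ} {c d g : ℝ → ℝ}

theorem hasDerivAt_integrating_factor (hc : Continuous c) {x d' : ℝ} (hd : HasDerivAt d d' x) :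
    HasDerivAt (fun y => d y * Real.exp (-∫ t in a..y, c t))
      ((d' - c x * d x) * Real.exp (-∫ t in a..x, c t)) x := by
  refine (hd.mul (hc.integral_hasStrictDerivAt a x).hasDerivAt.neg.exp).congr_deriv ?_
  simp only [Pi.neg_apply]
  ring

theorem monotoneOn_integrating_factor (hc : Continuous c)
    (hd : ∀ x ∈ Set.Icc a b, HasDerivAt d (c x * d x + g x) x) (hg : ∀ x ∈ Set.Icc a b, 0 ≤ g x) :
    MonotoneOn (fun y => d y * Real.exp (-∫ t in a..y, c t)) (Set.Icc a b) := by
  have h : ∀ x ∈ Set.Icc a b, HasDerivAt (fun y => d y * Real.exp (-∫ t in a..y, c t))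
      (g x * Real.exp (-∫ t in a..x, c t)) x := fun x hx => by
    refine (hasDerivAt_integrating_factor (a := a) hc (hd x hx)).congr_deriv ?_
    ring
  refine monotoneOn_of_deriv_nonneg (convex_Icc a b)
    (fun x hx => (h x hx).continuousAt.continuousWithinAt)
    (fun x hx => (h x (interior_subset hx)).differentiableAt.differentiableWithinAt)
    (fun x hx => ?_)
  rw [(h x (interior_subset hx)).deriv]
  exact mul_nonneg (hg x (interior_subset hx)) (Real.exp_pos _).le

theorem nonneg_of_linear_ode (hab : a ≤ b) (hc : Continuous c)
    (hd : ∀ x ∈ Set.Icc a b, HasDerivAt d (c x * d x + g x) x) (hg : ∀ x ∈ Set.Icc a b, 0 ≤ g x)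
    (ha : 0 ≤ d a) : 0 ≤ d b := by
  have h := monotoneOn_integrating_factor hc hd hg (Set.left_mem_Icc.2 hab)
    (Set.right_mem_Icc.2 hab) hab
  simp only [intervalIntegral.integral_same, neg_zero, Real.exp_zero, mul_one] at h
  exact nonneg_of_mul_nonneg_left (ha.trans h) (Real.exp_pos _)

/-- One interior point with positive source is enough, without continuity of `g`: if `d b ≤ 0`,
monotonicity of `d` times the integrating factor forces `d = 0` on all of `[a, b]`, so the equation
at `x₁` reads `0 = g x₁`. -/
theorem pos_of_linear_ode (hc : Continuous c)
    (hd : ∀ x ∈ Set.Icc a b, HasDerivAt d (c x * d x + g x) x) (hg : ∀ x ∈ Set.Icc a b, 0 ≤ g x)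
    (ha : 0 ≤ d a) {x₁ : ℝ} (hx₁ : x₁ ∈ Set.Ioo a b) (hgx : 0 < g x₁) : 0 < d b := by
  have hab : a ≤ b := (hx₁.1.trans hx₁.2).le
  have hm := monotoneOn_integrating_factor hc hd hg
  by_contra! hb
  have hzero : ∀ x ∈ Set.Icc a b, d x = 0 := fun x hx => by
    have h1 := hm (Set.left_mem_Icc.2 hab) hx hx.1
    have h2 := hm hx (Set.right_mem_Icc.2 hab) hx.2
    simp only [intervalIntegral.integral_same, neg_zero, Real.exp_zero, mul_one] at h1
    have h3 := h2.trans (mul_nonpos_of_nonpos_of_nonneg hb (Real.exp_pos _).le)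
    have h4 : d x * Real.exp (-∫ t in a..x, c t) = 0 := le_antisymm h3 (ha.trans h1)
    exact (mul_eq_zero.1 h4).resolve_right (Real.exp_pos _).ne'
  have h5 : d =ᶠ[𝓝 x₁] fun _ => 0 :=
    Filter.eventually_of_mem (Icc_mem_nhds hx₁.1 hx₁.2) hzero
  have h6 := (hd x₁ ⟨hx₁.1.le, hx₁.2.le⟩).unique
    ((hasDerivAt_const x₁ (0 : ℝ)).congr_of_eventuallyEq h5)
  rw [hzero x₁ ⟨hx₁.1.le, hx₁.2.le⟩] at h6
  linarith

end LinearComparison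

variable {W : ℝ → ℝ} {s μ ν a b : ℝ} {θ φ : ℝ → ℝ}

/-- The right-hand side is bounded and globally Lipschitz in the angle, so a single Picard–Lindelöf
step covers the interval. Solving on `[a-1, b+1]` gives two-sided derivatives at `a` and `b`;
constant extension gives global continuity. -/
theorem exists_isPruferAngle (hW : Continuous W) (s μ : ℝ) (hab : a ≤ b) :
    ∃ θ, IsPruferAngle W s μ a b θ := by
  obtain ⟨M, hM⟩ := (isCompact_Icc (a := a - 1) (b := b + 1)).exists_bound_of_continuousOn
    (f := fun x => (μ - W x) / s - s) (by fun_prop)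
  have hM0 : 0 ≤ M := (norm_nonneg _).trans (hM a ⟨by linarith, by linarith⟩)
  let t₀ : Set.Icc (a - 1) (b + 1) := ⟨a, by linarith, by linarith⟩
  have hL : 0 ≤ |s| + M := by positivity
  have hT : 0 ≤ (|s| + M) * (b - a + 1) := mul_nonneg hL (by linarith)
  have hpl : IsPicardLindelof (fun x y => s + ((μ - W x) / s - s) * Real.sin y ^ 2) t₀ 0
      ⟨_, hT⟩ 0 ⟨_, hL⟩ ⟨M, hM0⟩ := by
    refine ⟨fun t ht => ?_, fun y _ => by fun_prop, fun t ht y _ => ?_, ?_⟩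
    · refine LipschitzWith.lipschitzOnWith (LipschitzWith.of_dist_le_mul fun x y => ?_)
      rw [Real.dist_eq, Real.dist_eq, add_sub_add_left_eq_sub, ← mul_sub, abs_mul]
      exact mul_le_mul (hM t ht) (abs_sin_sq_sub_sin_sq_le x y) (abs_nonneg _) hM0
    · refine (norm_add_le _ _).trans (add_le_add le_rfl ?_)
      rw [norm_mul]
      refine mul_le_of_le_of_factor_le_one (hM t ht) (norm_nonneg _) ?_
      rw [Real.norm_eq_abs, abs_of_nonneg (sq_nonneg _)]
      exact Real.sin_sq_le_one y
    · change (|s| + M) * max (b + 1 - a) (a - (a - 1)) ≤ (|s| + M) * (b - a + 1) - 0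
      rw [max_eq_left (by linarith)]
      apply le_of_eq; ring
  obtain ⟨α, hα0, hα⟩ := hpl.exists_eq_forall_mem_Icc_hasDerivWithinAt₀
  have hlt : a - 1 ≤ b + 1 := by linarith
  refine ⟨fun x => α (Set.projIcc (a - 1) (b + 1) hlt x), ?_, ?_, fun x hx => ?_⟩
  · have hc : ContinuousOn α (Set.Icc (a - 1) (b + 1)) := fun x hx => (hα x hx).continuousWithinAt
    exact hc.domRestrict.comp continuous_projIcc
  · rw [Set.projIcc_of_mem hlt ⟨by linarith, by linarith⟩]
    exact hα0
  · have hx' : x ∈ Set.Ioo (a - 1) (b + 1) := ⟨by linarith [hx.1], by linarith [hx.2]⟩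
    have hev : (fun x => α (Set.projIcc (a - 1) (b + 1) hlt x)) =ᶠ[𝓝 x] α := by
      filter_upwards [Icc_mem_nhds hx'.1 hx'.2] with y hy
      rw [Set.projIcc_of_mem hlt hy]
    have h := (hα x ⟨hx'.1.le, hx'.2.le⟩).hasDerivAt (Icc_mem_nhds hx'.1 hx'.2)
    rw [← hev.eq_of_nhds] at h
    exact h.congr_of_eventuallyEq hev

namespace IsPruferAngle

theorem right_pos (hW : Continuous W) (hs : 0 < s) (hab : a < b) (hθ : IsPruferAngle W s μ a b θ) :
    0 < θ b := by
  have hθc := hθ.continuous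
  refine pos_of_linear_ode (g := fun _ => s) (a := a)
    (c := fun x => ((μ - W x) / s - s) * Real.sin (θ x) * Real.sinc (θ x))
    (by fun_prop) (fun x hx => ?_) (fun _ _ => hs.le) hθ.init.ge
    (x₁ := (a + b) / 2) ⟨by linarith, by linarith⟩ hs
  refine (hθ.hasDerivAt x hx).congr_deriv ?_
  have := sin_eq_sinc_mul (θ x)
  linear_combination (((μ - W x) / s - s) * Real.sin (θ x)) * this

/-- Below the potential the angle cannot cross `π/2`: at `θ = π/2` its derivative is `(μ - W)/s ≤
0`. This anchors the count of eigenvalues from below. -/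
theorem right_le_pi_div_two (hs : 0 < s) (hab : a ≤ b)
    (hθ : IsPruferAngle W s μ a b θ) (hμ : ∀ x ∈ Set.Icc a b, μ ≤ W x) : θ b ≤ Real.pi / 2 := by
  have hθc := hθ.continuous
  rw [← sub_nonneg]
  refine nonneg_of_linear_ode (g := fun x => (W x - μ) / s * Real.sin (θ x) ^ 2) (a := a)
    (d := fun x => Real.pi / 2 - θ x)
    (c := fun x => -s * Real.cos (θ x) * Real.sinc (Real.pi / 2 - θ x))
    hab (by fun_prop) (fun x hx => ?_) (fun x hx => ?_) ?_
  · refine ((hθ.hasDerivAt x hx).const_sub (Real.pi / 2)).congr_deriv ?_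
    have h1 := sin_eq_sinc_mul (Real.pi / 2 - θ x)
    rw [Real.sin_pi_div_two_sub] at h1
    have h2 := Real.sin_sq_add_cos_sq (θ x)
    linear_combination (-s * Real.cos (θ x)) * h1 + s * h2
  · exact mul_nonneg (div_nonneg (sub_nonneg.2 (hμ x hx)) hs.le) (sq_nonneg _)
  · simp only [hθ.init]
    linarith [Real.pi_pos]

theorem right_lt_right (hW : Continuous W) (hs : 0 < s) (hab : a < b)
    (hθ : IsPruferAngle W s μ a b θ) (hφ : IsPruferAngle W s ν a b φ) (hμν : μ < ν) :
    θ b < φ b := by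
  have hθc := hθ.continuous
  have hφc := hφ.continuous
  rw [← sub_pos]
  have hb := hθ.right_pos hW hs hab
  have hm : 0 < min (θ b) Real.pi := lt_min hb Real.pi_pos
  -- The source `(ν - μ)/s * sin² θ` vanishes at multiples of `π`; strictness needs an interior
  -- point with angle in `(0, π)`.
  obtain ⟨x₁, hx₁, hsin⟩ : ∃ x₁ ∈ Set.Ioo a b, θ x₁ = min (θ b) Real.pi / 2 := by
    refine intermediate_value_Ioo hab.le hθc.continuousOn ⟨?_, ?_⟩
    · rw [hθ.init]; linarith
    · linarith [min_le_left (θ b) Real.pi]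
  refine pos_of_linear_ode (g := fun x => (ν - μ) / s * Real.sin (θ x) ^ 2) (a := a)
    (d := fun x => φ x - θ x)
    (c := fun x => ((ν - W x) / s - s) * Real.sin (φ x + θ x) * Real.sinc (φ x - θ x))
    (by fun_prop) (fun x hx => ?_)
    (fun x hx => mul_nonneg (div_nonneg (sub_nonneg.2 hμν.le) hs.le) (sq_nonneg _))
    (by simp [hθ.init, hφ.init]) hx₁ ?_
  · refine ((hφ.hasDerivAt x hx).sub (hθ.hasDerivAt x hx)).congr_deriv ?_
    have h1 := sin_eq_sinc_mul (φ x - θ x)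
    have h2 := sin_sq_sub_sin_sq (φ x) (θ x)
    linear_combination (((ν - W x) / s - s) * Real.sin (φ x + θ x)) * h1
      + ((ν - W x) / s - s) * h2
  · refine mul_pos (div_pos (sub_pos.2 hμν) hs) (pow_pos ?_ 2)
    rw [hsin]
    exact Real.sin_pos_of_pos_of_lt_pi (by linarith)
      (by linarith [min_le_right (θ b) Real.pi, Real.pi_pos])

/-- Grönwall: `φ` solves the equation of `θ` up to an error `|ν - μ|/s`, with the same initial
value. -/
theorem abs_right_sub_le (hs : 0 < s) {K : ℝ} (hK0 : 0 ≤ K)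
    (hK : ∀ x ∈ Set.Icc a b, |(μ - W x) / s - s| ≤ K) (hab : a ≤ b)
    (hθ : IsPruferAngle W s μ a b θ) (hφ : IsPruferAngle W s ν a b φ) :
    |φ b - θ b| ≤ gronwallBound 0 K (|ν - μ| / s) (b - a) := by
  have h := dist_le_of_approx_trajectories_ODE_of_mem (K := ⟨K, hK0⟩) (δ := 0) (a := a) (b := b)
    (v := fun x y => s + ((μ - W x) / s - s) * Real.sin y ^ 2) (s := fun _ => Set.univ)
    (f := φ) (g := θ) (f' := fun x => s + ((ν - W x) / s - s) * Real.sin (φ x) ^ 2)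
    (g' := fun x => s + ((μ - W x) / s - s) * Real.sin (θ x) ^ 2)
    (εf := |ν - μ| / s) (εg := 0)
    (fun t ht => LipschitzWith.lipschitzOnWith (LipschitzWith.of_dist_le_mul fun x y => ?_))
    hφ.continuous.continuousOn
    (fun t ht => (hφ.hasDerivAt t ⟨ht.1, ht.2.le⟩).hasDerivWithinAt)
    (fun t ht => ?_) (fun _ _ => trivial) hθ.continuous.continuousOn
    (fun t ht => (hθ.hasDerivAt t ⟨ht.1, ht.2.le⟩).hasDerivWithinAt)
    (fun t ht => by simp) (fun _ _ => trivial) (by simp [hθ.init, hφ.init])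
    b ⟨hab, le_rfl⟩
  · simpa [Real.dist_eq] using! h
  · rw [Real.dist_eq, Real.dist_eq, add_sub_add_left_eq_sub, ← mul_sub, abs_mul]
    exact mul_le_mul (hK t ⟨ht.1, ht.2.le⟩) (abs_sin_sq_sub_sin_sq_le x y) (abs_nonneg _) hK0
  · rw [Real.dist_eq, add_sub_add_left_eq_sub, ← sub_mul, abs_mul,
      abs_of_nonneg (sq_nonneg (Real.sin (φ t)))]
    refine mul_le_of_le_of_factor_le_one (le_of_eq ?_) (by positivity) (Real.sin_sq_le_one _)
    rw [← abs_of_pos hs, ← abs_div, abs_of_pos hs]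
    congr 1
    ring

end IsPruferAngle

theorem continuous_pruferAngle_right (hW : Continuous W) (hs : 0 < s) (hab : a ≤ b)
    {Φ : ℝ → ℝ → ℝ} (hΦ : ∀ μ, IsPruferAngle W s μ a b (Φ μ)) : Continuous fun μ => Φ μ b := by
  refine continuous_iff_continuousAt.2 fun μ => ?_
  obtain ⟨K, hK⟩ := (isCompact_Icc (a := a) (b := b)).exists_bound_of_continuousOn
    (f := fun x => (μ - W x) / s - s) (by fun_prop)
  have hK0 : 0 ≤ K := (norm_nonneg _).trans (hK a ⟨le_rfl, hab⟩)
  refine tendsto_iff_dist_tendsto_zero.2 (squeeze_zero (fun _ => dist_nonneg)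
    (g := fun ν => gronwallBound 0 K (|ν - μ| / s) (b - a)) (fun ν => ?_) ?_)
  · exact (hΦ μ).abs_right_sub_le hs hK0 hK hab (hΦ ν)
  · have hc : Continuous fun ν => gronwallBound 0 K (|ν - μ| / s) (b - a) := by
      by_cases h : K = 0
      · subst h; simp only [gronwallBound_K0]; fun_prop
      · simp only [gronwallBound_of_K_ne_0 h]; fun_prop
    simpa [gronwallBound_ε0] using! hc.tendsto μ

/-- The phase with the momentum of the free problem as scale is almost linear. -/
theorem IsPruferAngle.abs_right_sub_free_le (hW : Continuous W) (hs : 0 < s) (hab : a ≤ b)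
    (hθ : IsPruferAngle W s μ a b θ) {w : ℝ} (hw : μ - w = s ^ 2) :
    |θ b - s * (b - a)| ≤ (∫ x in a..b, |W x - w|) / s := by
  have hθc := hθ.continuous
  have h1 : ∫ x in a..b, (s + ((μ - W x) / s - s) * Real.sin (θ x) ^ 2) = θ b - θ a :=
    intervalIntegral.integral_eq_sub_of_hasDerivAt
      (fun x hx => hθ.hasDerivAt x (by rwa [Set.uIcc_of_le hab] at hx))
      (Continuous.intervalIntegrable (by fun_prop) _ _)
  rw [intervalIntegral.integral_add (by simp) (Continuous.intervalIntegrable (by fun_prop) _ _),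
    hθ.init] at h1
  simp only [intervalIntegral.integral_const, smul_eq_mul, sub_zero] at h1
  rw [← h1, mul_comm, add_sub_cancel_left, ← Real.norm_eq_abs, ← intervalIntegral.integral_div]
  refine intervalIntegral.norm_integral_le_of_norm_le hab (ae_of_all _ fun x _ => ?_)
    (Continuous.intervalIntegrable (by fun_prop) _ _)
  rw [norm_mul, Real.norm_eq_abs, Real.norm_eq_abs, abs_of_nonneg (sq_nonneg (Real.sin (θ x)))]
  refine mul_le_of_le_of_factor_le_one (le_of_eq ?_) (by positivity) (Real.sin_sq_le_one _)
  -- With `s² = μ - w` the free part of the coefficient cancels; only the deviation of `W` from `w`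
  -- remains.
  have : (μ - W x) / s - s = -((W x - w) / s) := by
    field_simp
    linarith
  rw [this, abs_neg, abs_div, abs_of_pos hs]

end

/-! ### Test functions, integration by parts and the du Bois-Reymond lemma -/

section

variable {a b : ℝ}

theorem exists_Icc_of_isCompact_subset_Ioo {K : Set ℝ} (hK : IsCompact K) (hab : a < b)
    (h : K ⊆ Set.Ioo a b) : ∃ c d, a < c ∧ c ≤ d ∧ d < b ∧ K ⊆ Set.Icc c d := by
  rcases K.eq_empty_or_nonempty with rfl | hne
  · exact ⟨(a + b) / 2, (a + b) / 2, by linarith, le_rfl, by linarith, by simp⟩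
  · obtain ⟨c, hc⟩ := hK.exists_isLeast hne
    obtain ⟨d, hd⟩ := hK.exists_isGreatest hne
    exact ⟨c, d, (h hc.1).1, hc.2 hd.1, (h hd.1).2, fun x hx => ⟨hc.2 hx, hd.2 hx⟩⟩

namespace IsTestFunction

variable {φ ψ : ℝ → ℂ} {Ω : Set ℝ}

theorem continuous (h : IsTestFunction Ω φ) : Continuous φ := h.1.continuous

theorem continuous_deriv (h : IsTestFunction Ω φ) : Continuous (deriv φ) :=
  h.1.continuous_deriv (by simp)

theorem hasDerivAt (h : IsTestFunction Ω φ) (x : ℝ) : HasDerivAt φ (deriv φ x) x :=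
  (h.1.differentiable (by simp) x).hasDerivAt

theorem eq_zero (h : IsTestFunction Ω φ) {x : ℝ} (hx : x ∉ Ω) : φ x = 0 :=
  image_eq_zero_of_notMem_tsupport fun h' => hx (h.2.2 h')

theorem sub (hφ : IsTestFunction Ω φ) (hψ : IsTestFunction Ω ψ) : IsTestFunction Ω (φ - ψ) :=
  ⟨hφ.1.sub hψ.1, hφ.2.1.sub hψ.2.1,
    (tsupport_sub φ ψ).trans (Set.union_subset hφ.2.2 hψ.2.2)⟩

theorem const_mul (hφ : IsTestFunction Ω φ) (c : ℂ) : IsTestFunction Ω fun x => c * φ x :=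
  ⟨contDiff_const.mul hφ.1, hφ.2.1.mul_left, (tsupport_mul_subset_right).trans hφ.2.2⟩

theorem of_tsupport_subset {f : ℝ → ℂ} (hf : ContDiff ℝ ((⊤ : ℕ∞) : WithTop ℕ∞) f)
    {K : Set ℝ} (hK : IsCompact K) (hfK : ∀ x ∉ K, f x = 0) (hKΩ : K ⊆ Ω) :
    IsTestFunction Ω f := by
  have h : tsupport f ⊆ K :=
    closure_minimal (fun x hx => by_contra fun h' => hx (hfK x h')) hK.isClosed
  exact ⟨hf, hK.of_isClosed_subset (isClosed_tsupport f) h, h.trans hKΩ⟩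

/-- A test function of mean zero on an interval is the derivative of a test function. -/
theorem primitive (hab : a < b) (hφ : IsTestFunction (Set.Ioo a b) φ)
    (h0 : ∫ x in a..b, φ x = 0) :
    IsTestFunction (Set.Ioo a b) (fun x => ∫ t in a..x, φ t) ∧
      deriv (fun x => ∫ t in a..x, φ t) = φ := by
  have hd : deriv (fun x => ∫ t in a..x, φ t) = φ := by
    ext x
    exact hφ.continuous.deriv_integral φ a x
  refine ⟨?_, hd⟩
  obtain ⟨c, d, hac, hcd, hdb, hK⟩ :=
    exists_Icc_of_isCompact_subset_Ioo hφ.2.1 hab hφ.2.2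
  have hz : ∀ x ∉ Set.Icc c d, φ x = 0 := fun x hx =>
    image_eq_zero_of_notMem_tsupport fun h' => hx (hK h')
  refine of_tsupport_subset (K := Set.Icc c d) ?_ isCompact_Icc (fun x hx => ?_)
    (Set.Icc_subset_Ioo hac hdb)
  · refine contDiff_infty_iff_deriv.2 ⟨fun x => ?_, by rw [hd]; exact hφ.1⟩
    exact (hφ.continuous.integral_hasStrictDerivAt a x).hasDerivAt.differentiableAt
  · rcases lt_or_ge x c with hxc | hxc
    · rw [intervalIntegral.integral_congr (g := fun _ => 0), intervalIntegral.integral_zero]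
      intro t ht
      have : t < c := by
        rcases Set.mem_uIcc.1 ht with h' | h' <;> linarith [h'.2]
      exact hz t fun h => absurd h.1 (not_le.2 this)
    · have hxd : d < x := by
        by_contra! h
        exact hx ⟨hxc, h⟩
      -- To the right of the support the primitive has already reached the full integral, which is
      -- zero.
      have h1 := intervalIntegral.integral_add_adjacent_intervals
        (hφ.continuous.intervalIntegrable a x) (hφ.continuous.intervalIntegrable x b) (μ := volume)
      have h2 : ∫ t in x..b, φ t = 0 := by
        rw [intervalIntegral.integral_congr (g := fun _ => 0), intervalIntegral.integral_zero]
        intro t ht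
        exact hz t fun h => by
          rcases Set.mem_uIcc.1 ht with h' | h' <;> linarith [h.2, h'.1, h'.2]
      rw [h0, h2, add_zero] at h1
      exact h1

end IsTestFunction

theorem setIntegral_Ioo_eq (hab : a ≤ b) (f : ℝ → ℂ) :
    ∫ x in Set.Ioo a b, f x = ∫ x in a..b, f x := by
  rw [intervalIntegral.integral_of_le hab, integral_Ioc_eq_integral_Ioo]

/-- Integration by parts against a test function. -/
theorem integral_mul_deriv_testFunction (hab : a ≤ b) {f f' φ : ℝ → ℂ} (hf' : Continuous f')
    (hf : ∀ x ∈ Set.Icc a b, HasDerivAt f (f' x) x) (hφ : IsTestFunction (Set.Ioo a b) φ) :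
    ∫ x in Set.Ioo a b, f x * deriv φ x = - ∫ x in Set.Ioo a b, f' x * φ x := by
  rw [setIntegral_Ioo_eq hab, setIntegral_Ioo_eq hab,
    intervalIntegral.integral_mul_deriv_eq_deriv_mul
      (fun x hx => hf x (by rwa [Set.uIcc_of_le hab] at hx)) (fun x _ => hφ.hasDerivAt x)
      (hf'.intervalIntegrable _ _) (hφ.continuous_deriv.intervalIntegrable _ _),
    hφ.eq_zero (x := a) (by simp), hφ.eq_zero (x := b) (by simp)]
  simp

/-- Smooth cut-off functions exhausting an open interval. -/
theorem exists_cutoff {η : ℝ} (hη : 0 < η) (hη' : η < (b - a) / 2) :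
    ∃ χ : ℝ → ℝ, ContDiff ℝ ((⊤ : ℕ∞) : WithTop ℕ∞) χ ∧ (∀ x, χ x ∈ Set.Icc (0 : ℝ) 1) ∧
      (∀ x ∈ Set.Icc (a + η) (b - η), χ x = 1) ∧
      ∀ x ∉ Set.Icc (a + η / 2) (b - η / 2), χ x = 0 := by
  let f : ContDiffBump ((a + b) / 2 : ℝ) :=
    ⟨(b - a) / 2 - η, (b - a) / 2 - η / 2, by linarith, by linarith⟩
  refine ⟨f, f.contDiff, fun x => ⟨f.nonneg, f.le_one⟩, fun x hx => ?_, fun x hx => ?_⟩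
  · refine f.one_of_mem_closedBall ?_
    rw [Metric.mem_closedBall, Real.dist_eq, abs_le]
    change -((b - a) / 2 - η) ≤ _ ∧ _ ≤ (b - a) / 2 - η
    constructor <;> linarith [hx.1, hx.2]
  · refine f.zero_of_le_dist ?_
    change (b - a) / 2 - η / 2 ≤ _
    rw [Real.dist_eq]
    by_contra! h
    rw [abs_lt] at h
    exact hx ⟨by linarith, by linarith⟩

theorem exists_testFunction_integral_eq_one (hab : a < b) :
    ∃ ψ : ℝ → ℂ, IsTestFunction (Set.Ioo a b) ψ ∧ ∫ x in a..b, ψ x = 1 := by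
  let f : ContDiffBump ((a + b) / 2 : ℝ) :=
    ⟨(b - a) / 8, (b - a) / 4, by linarith, by linarith⟩
  have hz : ∀ x ∉ Metric.closedBall ((a + b) / 2) ((b - a) / 4), f.normed volume x = 0 := by
    intro x hx
    have : x ∉ tsupport (f.normed volume) := by rwa [f.tsupport_normed_eq]
    exact image_eq_zero_of_notMem_tsupport this
  have hsub : Metric.closedBall ((a + b) / 2) ((b - a) / 4) ⊆ Set.Ioo a b := by
    rw [Real.closedBall_eq_Icc]
    exact Set.Icc_subset_Ioo (by linarith) (by linarith)
  refine ⟨fun x => (f.normed volume x : ℂ), IsTestFunction.of_tsupport_subset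
    (Complex.ofRealCLM.contDiff.comp f.contDiff_normed) (isCompact_closedBall _ _)
    (fun x hx => by simp [hz x hx]) hsub, ?_⟩
  rw [intervalIntegral.integral_ofReal]
  have h := f.integral_normed (μ := volume)
  rw [← setIntegral_eq_integral_of_forall_compl_eq_zero (s := Set.Ioc a b)
    (fun x hx => hz x fun h' => hx (Set.Ioo_subset_Ioc_self (hsub h')))] at h
  rw [intervalIntegral.integral_of_le hab.le, h, Complex.ofReal_one]

/-- The du Bois-Reymond lemma. -/
theorem ae_eq_const_of_integral_mul_deriv_eq_zero (hab : a < b) {f : ℝ → ℂ}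
    (hf : IntegrableOn f (Set.Ioo a b))
    (h : ∀ φ, IsTestFunction (Set.Ioo a b) φ → ∫ x in Set.Ioo a b, f x * deriv φ x = 0) :
    ∃ c : ℂ, ∀ᵐ x ∂(volume.restrict (Set.Ioo a b)), f x = c := by
  obtain ⟨ψ, hψ, hψ1⟩ := exists_testFunction_integral_eq_one hab
  have hmul : ∀ {φ : ℝ → ℂ}, IsTestFunction (Set.Ioo a b) φ →
      Integrable (fun x => f x * φ x) (volume.restrict (Set.Ioo a b)) := fun {φ} hφ => by
    obtain ⟨C, hC⟩ := hφ.continuous.bounded_above_of_compact_support hφ.2.1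
    exact hf.mul_bdd (c := C) hφ.continuous.aestronglyMeasurable (ae_of_all _ hC)
  refine ⟨∫ x in Set.Ioo a b, f x * ψ x, ?_⟩
  set c := ∫ x in Set.Ioo a b, f x * ψ x with hc
  rw [ae_restrict_iff' measurableSet_Ioo]
  have key := isOpen_Ioo.ae_eq_zero_of_integral_contDiff_smul_eq_zero (μ := volume)
    (f := fun x => f x - c) (U := Set.Ioo a b)
    ((hf.sub (integrableOn_const (by simp))).locallyIntegrableOn) (fun g hg hgc hgs => ?_)
  · filter_upwards [key] with x hx hx'
    exact sub_eq_zero.1 (hx hx')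
  · have hG : IsTestFunction (Set.Ioo a b) (fun x => (g x : ℂ)) :=
      IsTestFunction.of_tsupport_subset (Complex.ofRealCLM.contDiff.comp hg) hgc
        (fun x hx => by simp [image_eq_zero_of_notMem_tsupport hx]) hgs
    -- Subtracting `I ψ` makes the mean zero, so that `g - I ψ` is the derivative of an admissible
    -- test function.
    set I : ℂ := ∫ x in a..b, (g x : ℂ) with hI
    have hH := hG.sub (hψ.const_mul I)
    obtain ⟨hP, hPd⟩ := hH.primitive hab (by
      simp only [Pi.sub_apply]
      rw [intervalIntegral.integral_sub (hG.continuous.intervalIntegrable _ _)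
        ((hψ.const_mul I).continuous.intervalIntegrable _ _),
        intervalIntegral.integral_const_mul, hψ1, mul_one, ← hI, sub_self])
    have h1 := h _ hP
    rw [hPd] at h1
    have h2 : ∀ x, f x * ((fun x => (g x : ℂ)) - fun x => I * ψ x) x
        = f x * (g x : ℂ) - I * (f x * ψ x) := fun x => by
      simp only [Pi.sub_apply]; ring
    simp only [h2] at h1
    rw [integral_sub (hmul hG) ((hmul hψ).const_mul I), integral_const_mul, ← hc] at h1
    have h3 : ∫ x, g x • (f x - c) = ∫ x in Set.Ioo a b, g x • (f x - c) := by
      refine (setIntegral_eq_integral_of_forall_compl_eq_zero fun x hx => ?_).symm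
      rw [image_eq_zero_of_notMem_tsupport fun h' => hx (hgs h'), zero_smul]
    have h4 : ∀ x, g x • (f x - c) = f x * (g x : ℂ) - c * (g x : ℂ) := fun x => by
      rw [Complex.real_smul]; ring
    rw [h3]
    simp only [h4]
    rw [integral_sub (hmul hG)
      ((hG.continuous.integrable_of_hasCompactSupport hG.2.1).restrict.const_mul c),
      integral_const_mul, setIntegral_Ioo_eq hab.le (fun x => (g x : ℂ)), ← hI]
    rw [sub_eq_zero] at h1 ⊢
    rw [h1, mul_comm]

end

/-! ### Regularity of weak eigenfunctions and density of test functions -/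

section

variable {a b : ℝ}

theorem eLpNorm_one_le_eLpNorm_two {f : ℝ → ℂ}
    (hf : AEStronglyMeasurable f (volume.restrict (Set.Ioo a b))) :
    eLpNorm f 1 (volume.restrict (Set.Ioo a b)) ≤
      eLpNorm f 2 (volume.restrict (Set.Ioo a b)) * ENNReal.ofReal (b - a) ^ (1 / 2 : ℝ) := by
  refine (eLpNorm_le_eLpNorm_mul_rpow_measure_univ (p := 1) (q := 2) (by norm_num) hf).trans
    (le_of_eq ?_)
  simp only [Measure.restrict_apply_univ, Real.volume_Ioo]
  norm_num

theorem tendsto_eLpNorm_one_of_two {f : ℕ → ℝ → ℂ}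
    (hf : ∀ n, AEStronglyMeasurable (f n) (volume.restrict (Set.Ioo a b)))
    (h : Tendsto (fun n => eLpNorm (f n) 2 (volume.restrict (Set.Ioo a b))) atTop (𝓝 0)) :
    Tendsto (fun n => eLpNorm (f n) 1 (volume.restrict (Set.Ioo a b))) atTop (𝓝 0) := by
  refine tendsto_of_tendsto_of_tendsto_of_le_of_le tendsto_const_nhds ?_ (fun _ => zero_le)
    (fun n => eLpNorm_one_le_eLpNorm_two (hf n))
  simpa using ENNReal.Tendsto.mul_const (b := ENNReal.ofReal (b - a) ^ (1 / 2 : ℝ)) h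
    (Or.inr (ENNReal.rpow_ne_top_of_nonneg (by norm_num) (by simp)))

theorem MemL2.integrableOn {u : ℝ → ℂ} (h : MemL2 (Set.Ioo a b) u) :
    IntegrableOn u (Set.Ioo a b) :=
  MemLp.integrable (by norm_num) h

theorem memL2_of_continuous {u : ℝ → ℂ} (h : Continuous u) : MemL2 (Set.Ioo a b) u := by
  obtain ⟨C, hC⟩ := (isCompact_Icc (a := a) (b := b)).exists_bound_of_continuousOn h.continuousOn
  refine MemLp.of_bound h.aestronglyMeasurable C ?_
  filter_upwards [self_mem_ae_restrict measurableSet_Ioo] with x hx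
  exact hC x (Set.Ioo_subset_Icc_self hx)

/-- A function in `H¹₀` of an interval is the primitive of its weak derivative, which has mean
zero. -/
theorem IsSobolevH10.ae_eq_primitive (hab : a < b) {u u₁ : ℝ → ℂ}
    (h : IsSobolevH10 (Set.Ioo a b) u u₁) :
    (∀ᵐ x ∂(volume.restrict (Set.Ioo a b)), u x = ∫ t in Set.Ioo a x, u₁ t) ∧
      ∫ t in Set.Ioo a b, u₁ t = 0 := by
  obtain ⟨φ, hφ, hφu, hφu₁⟩ := h.approx
  -- On a bounded interval `L²` convergence of `deriv (φ n)` gives `L¹` convergence, hence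
  -- convergence of `φ n` at every point, both ends included.
  have hlim : ∀ x ∈ Set.Icc a b, Tendsto (fun n => φ n x) atTop (𝓝 (∫ t in Set.Ioo a x, u₁ t)) := by
    intro x hx
    have h1 := tendsto_setIntegral_of_L1' u₁ h.memL2_deriv.1
      (F := fun n => deriv (φ n)) (l := atTop)
      (Eventually.of_forall fun n => (memL2_of_continuous (hφ n).continuous_deriv).integrableOn)
      (tendsto_eLpNorm_one_of_two (fun n => (hφ n).continuous_deriv.aestronglyMeasurable.sub
        h.memL2_deriv.1) hφu₁) (Set.Ioo a x)
    rw [Measure.restrict_restrict measurableSet_Ioo,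
      Set.inter_eq_left.2 (Set.Ioo_subset_Ioo_right hx.2)] at h1
    refine h1.congr fun n => ?_
    rw [setIntegral_Ioo_eq hx.1, intervalIntegral.integral_eq_sub_of_hasDerivAt
      (fun y _ => (hφ n).hasDerivAt y) ((hφ n).continuous_deriv.intervalIntegrable _ _),
      (hφ n).eq_zero (x := a) (by simp), sub_zero]
  constructor
  · obtain ⟨ns, hns, hae⟩ := (tendstoInMeasure_of_tendsto_eLpNorm two_ne_zero
      (fun n => (hφ n).continuous.aestronglyMeasurable) h.memL2.1 hφu).exists_seq_tendsto_ae
    filter_upwards [hae, self_mem_ae_restrict measurableSet_Ioo] with x hx hxI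
    exact tendsto_nhds_unique hx
      ((hlim x (Set.Ioo_subset_Icc_self hxI)).comp hns.tendsto_atTop)
  · refine tendsto_nhds_unique (hlim b ⟨hab.le, le_rfl⟩) ?_
    simp [(hφ _).eq_zero (x := b)]

/-- Dirichlet eigenfunctions are classical solutions. -/
theorem IsDirichletEigenvalue.exists_classical (hab : a < b) {V : ℝ → ℝ} (hV : Continuous V)
    {ħ E : ℝ} (hħ : 0 < ħ) (h : IsDirichletEigenvalue ħ V (Set.Ioo a b) E) :
    ∃ y y₁ : ℝ → ℂ, (∀ x ∈ Set.Icc a b, HasDerivAt y (y₁ x) x) ∧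
      (∀ x ∈ Set.Icc a b, HasDerivAt y₁ (((V x / ħ ^ 2 - E / ħ ^ 2 : ℝ) : ℂ) * y x) x) ∧
      y a = 0 ∧ y b = 0 ∧ ∃ x ∈ Set.Icc a b, y x ≠ 0 := by
  obtain ⟨u, u₁, u₂, hH2, hH10, hne, heq⟩ := h
  obtain ⟨hu, hu₁0⟩ := hH10.ae_eq_primitive hab
  have hu₁i : IntegrableOn u₁ (Set.Ioo a b) := hH10.memL2_deriv.integrableOn
  set w : ℝ → ℂ := fun x => ∫ t in a..x, (Set.Ioo a b).indicator u₁ t with hw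
  have hwc : Continuous w :=
    intervalIntegral.continuous_primitive
      (fun _ _ => ((integrable_indicator_iff measurableSet_Ioo).2 hu₁i).intervalIntegrable) a
  have hwx : ∀ x ∈ Set.Icc a b, w x = ∫ t in Set.Ioo a x, u₁ t := fun x hx => by
    rw [hw]
    simp only
    rw [← setIntegral_Ioo_eq hx.1]
    exact setIntegral_congr_fun measurableSet_Ioo fun t ht =>
      Set.indicator_of_mem (Set.Ioo_subset_Ioo_right hx.2 ht) _
  have huw : ∀ᵐ x ∂(volume.restrict (Set.Ioo a b)), u x = w x := by
    filter_upwards [hu, self_mem_ae_restrict measurableSet_Ioo] with x hx hxI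
    rw [hx, hwx x (Set.Ioo_subset_Icc_self hxI)]
  set q : ℝ → ℂ := fun x => ((V x / ħ ^ 2 - E / ħ ^ 2 : ℝ) : ℂ) with hq
  have hqc : Continuous q := by fun_prop
  have hu₂ : ∀ᵐ x ∂(volume.restrict (Set.Ioo a b)), u₂ x = q x * w x := by
    filter_upwards [huw, heq] with x hx hx'
    have hħ' : (ħ : ℂ) ≠ 0 := by exact_mod_cast hħ.ne'
    rw [← hx, hq]
    push_cast
    field_simp
    linear_combination -hx'
  -- `W₁` is a classical primitive of `u₂`, so `u₁ - W₁` has zero weak derivative and is constant.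
  set W₁ : ℝ → ℂ := fun x => ∫ t in a..x, q t * w t with hW₁
  have hW₁d : ∀ x, HasDerivAt W₁ (q x * w x) x := fun x =>
    ((hqc.mul hwc).integral_hasStrictDerivAt a x).hasDerivAt
  have hW₁c : Continuous W₁ := continuous_iff_continuousAt.2 fun x => (hW₁d x).continuousAt
  have hmul : ∀ {f φ : ℝ → ℂ}, IntegrableOn f (Set.Ioo a b) → IsTestFunction (Set.Ioo a b) φ →
      IntegrableOn (fun x => f x * deriv φ x) (Set.Ioo a b) := fun {f φ} hf hφ => by
    obtain ⟨C, hC⟩ := hφ.continuous_deriv.bounded_above_of_compact_support hφ.2.1.deriv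
    exact hf.mul_bdd (c := C) hφ.continuous_deriv.aestronglyMeasurable (ae_of_all _ hC)
  have hW₁i : IntegrableOn W₁ (Set.Ioo a b) := (memL2_of_continuous hW₁c).integrableOn
  obtain ⟨c, hc⟩ := ae_eq_const_of_integral_mul_deriv_eq_zero hab (f := fun x => u₁ x - W₁ x)
    (hu₁i.sub hW₁i) (fun φ hφ => by
      have h1 := hH2.weakDeriv2 φ hφ
      have h2 := integral_mul_deriv_testFunction (f' := fun x => q x * w x) hab.le
        (hqc.mul hwc) (fun x _ => hW₁d x) hφ
      have h3 : ∫ x in Set.Ioo a b, u₂ x * φ x = ∫ x in Set.Ioo a b, q x * w x * φ x :=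
        integral_congr_ae (by filter_upwards [hu₂] with x hx; rw [hx])
      simp only [sub_mul]
      rw [integral_sub (hmul hu₁i hφ) (hmul hW₁i hφ), h1, h2, h3, sub_self])
  set y : ℝ → ℂ := fun x => ∫ t in a..x, (c + W₁ t) with hy
  have hyw : ∀ x ∈ Set.Icc a b, y x = w x := fun x hx => by
    rw [hwx x hx, hy]
    simp only
    rw [← setIntegral_Ioo_eq hx.1]
    refine integral_congr_ae ?_
    filter_upwards [ae_restrict_of_ae_restrict_of_subset (Set.Ioo_subset_Ioo_right hx.2) hc]
      with t ht
    rw [← ht]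
    ring
  refine ⟨y, fun x => c + W₁ x, fun x _ => ?_, fun x hx => ?_, ?_, ?_, ?_⟩
  · exact ((continuous_const.add hW₁c).integral_hasStrictDerivAt a x).hasDerivAt
  · rw [hyw x hx]
    exact (hW₁d x).const_add c
  · simp [hy]
  · rw [hyw b ⟨hab.le, le_rfl⟩, hwx b ⟨hab.le, le_rfl⟩, hu₁0]
  · by_contra! h0
    refine hne ?_
    filter_upwards [huw, self_mem_ae_restrict measurableSet_Ioo] with x hx hxI
    have hxI' := Set.Ioo_subset_Icc_self hxI
    rw [hx, ← hyw x hxI', h0 x hxI']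

/-- Test functions are dense in `L²` of an interval. -/
theorem MemL2.exists_testFunction_near (hab : a < b) {u : ℝ → ℂ} (hu : MemL2 (Set.Ioo a b) u)
    {δ : ℝ} (hδ : 0 < δ) : ∃ g, IsTestFunction (Set.Ioo a b) g ∧
      eLpNorm (g - u) 2 (volume.restrict (Set.Ioo a b)) ≤ ENNReal.ofReal δ := by
  obtain ⟨g, hgc, hg, hgu⟩ := MemLp.exist_eLpNorm_sub_le (by norm_num) (by norm_num) hu
    (half_pos hδ)
  obtain ⟨M, hM⟩ := hg.continuous.bounded_above_of_compact_support hgc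
  have hM0 : 0 ≤ M := (norm_nonneg _).trans (hM 0)
  -- The smooth approximation `g` need not be supported in the interval. Cutting it off within `η`
  -- of both ends changes it by at most `M` on a set of measure at most `2η`.
  have htend : Tendsto (fun η : ℝ => M * (2 * η) ^ (1 / 2 : ℝ)) (𝓝[>] 0) (𝓝 0) := by
    have : Continuous fun η : ℝ => M * (2 * η) ^ (1 / 2 : ℝ) :=
      continuous_const.mul ((continuous_const.mul continuous_id).rpow_const
        fun _ => Or.inr (by norm_num))
    simpa using (this.tendsto 0).mono_left nhdsWithin_le_nhds
  obtain ⟨η, hηδ, hη0, hηab⟩ : ∃ η : ℝ, M * (2 * η) ^ (1 / 2 : ℝ) < δ / 2 ∧ 0 < η ∧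
      η < (b - a) / 2 := by
    have h1 := htend.eventually (gt_mem_nhds (half_pos hδ))
    have h2 : ∀ᶠ η in 𝓝[>] (0 : ℝ), η ∈ Set.Ioo 0 ((b - a) / 2) :=
      Ioo_mem_nhdsGT (by linarith)
    obtain ⟨η, h3, h4⟩ := (h1.and h2).exists
    exact ⟨η, h3, h4.1, h4.2⟩
  obtain ⟨χ, hχ, hχ01, hχ1, hχ0⟩ := exists_cutoff (a := a) (b := b) hη0 hηab
  have hG : IsTestFunction (Set.Ioo a b) (fun x => (χ x : ℂ) * g x) :=
    IsTestFunction.of_tsupport_subset ((Complex.ofRealCLM.contDiff.comp hχ).mul hg) isCompact_Icc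
      (K := Set.Icc (a + η / 2) (b - η / 2))
      (fun x hx => by simp [hχ0 x hx]) (Set.Icc_subset_Ioo (by linarith) (by linarith))
  refine ⟨_, hG, ?_⟩
  set T : Set ℝ := Set.Ioo a (a + η) ∪ Set.Ioo (b - η) b with hT
  have hTm : MeasurableSet T := measurableSet_Ioo.union measurableSet_Ioo
  have hcut : eLpNorm ((fun x => (χ x : ℂ) * g x) - g) 2 (volume.restrict (Set.Ioo a b)) ≤
      ENNReal.ofReal (δ / 2) := by
    calc eLpNorm ((fun x => (χ x : ℂ) * g x) - g) 2 (volume.restrict (Set.Ioo a b))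
        ≤ eLpNorm (T.indicator fun _ => M) 2 (volume.restrict (Set.Ioo a b)) := by
          refine eLpNorm_mono_ae ?_
          filter_upwards [self_mem_ae_restrict measurableSet_Ioo] with x hx
          have h1 : ((fun x => (χ x : ℂ) * g x) - g) x = ((χ x - 1 : ℝ) : ℂ) * g x := by
            simp only [Pi.sub_apply]; push_cast; ring
          rw [h1]
          by_cases hxT : x ∈ T
          · rw [Set.indicator_of_mem hxT, norm_mul, Complex.norm_real, Real.norm_eq_abs,
              Real.norm_eq_abs, abs_of_nonneg hM0]
            have h2 : |χ x - 1| ≤ 1 := abs_le.2 ⟨by linarith [(hχ01 x).1], by linarith [(hχ01 x).2]⟩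
            calc |χ x - 1| * ‖g x‖ ≤ 1 * M := mul_le_mul h2 (hM x) (norm_nonneg _) zero_le_one
              _ = M := one_mul M
          · have hxI : x ∈ Set.Icc (a + η) (b - η) := by
              constructor
              · by_contra! h'
                exact hxT (Or.inl ⟨hx.1, h'⟩)
              · by_contra! h'
                exact hxT (Or.inr ⟨h', hx.2⟩)
            rw [hχ1 x hxI]
            simp
      _ ≤ eLpNorm (T.indicator fun _ => M) 2 volume := eLpNorm_mono_measure _ Measure.restrict_le_self
      _ ≤ ‖M‖ₑ * volume T ^ (1 / (2 : ENNReal).toReal) := eLpNorm_indicator_const_le M 2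
      _ ≤ ENNReal.ofReal M * ENNReal.ofReal (2 * η) ^ (1 / 2 : ℝ) := by
          rw [Real.enorm_eq_ofReal hM0]
          refine mul_le_mul_right ?_ _
          have : volume T ≤ ENNReal.ofReal (2 * η) := by
            refine (measure_union_le _ _).trans ?_
            rw [Real.volume_Ioo, Real.volume_Ioo, ← ENNReal.ofReal_add (by linarith) (by linarith)]
            exact ENNReal.ofReal_le_ofReal (by linarith)
          simpa using! ENNReal.rpow_le_rpow this (by norm_num : (0 : ℝ) ≤ 1 / 2)
      _ = ENNReal.ofReal (M * (2 * η) ^ (1 / 2 : ℝ)) := by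
          rw [ENNReal.ofReal_mul hM0, ENNReal.ofReal_rpow_of_nonneg (by linarith) (by norm_num)]
      _ ≤ ENNReal.ofReal (δ / 2) := ENNReal.ofReal_le_ofReal hηδ.le
  calc eLpNorm ((fun x => (χ x : ℂ) * g x) - u) 2 (volume.restrict (Set.Ioo a b))
      = eLpNorm (((fun x => (χ x : ℂ) * g x) - g) + (g - u)) 2 (volume.restrict (Set.Ioo a b)) := by
        rw [sub_add_sub_cancel]
    _ ≤ _ := eLpNorm_add_le (hG.continuous.sub hg.continuous).aestronglyMeasurable
        (hg.continuous.aestronglyMeasurable.sub hu.1) (by norm_num)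
    _ ≤ ENNReal.ofReal (δ / 2) + ENNReal.ofReal (δ / 2) := by
        refine add_le_add hcut ?_
        rw [eLpNorm_sub_comm]
        exact hgu
    _ = ENNReal.ofReal δ := by
        rw [← ENNReal.ofReal_add (by linarith) (by linarith), add_halves]

end

/-! ### Classical Dirichlet solutions and the Prüfer criterion for eigenvalues -/

section

variable {a b : ℝ}

/-- Approximate `y₁` in `L²` by test functions, correct their means to zero by multiples of a fixed
`ψ`, and take primitives. The corrections tend to zero because `∫ y₁ = y b - y a = 0`. -/
theorem isSobolevH10_of_hasDerivAt (hab : a < b) {y y₁ : ℝ → ℂ} (hy : Continuous y)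
    (hy₁ : Continuous y₁) (hd : ∀ x ∈ Set.Icc a b, HasDerivAt y (y₁ x) x) (ha : y a = 0)
    (hb : y b = 0) : IsSobolevH10 (Set.Ioo a b) y y₁ := by
  refine ⟨memL2_of_continuous hy, memL2_of_continuous hy₁, ?_⟩
  obtain ⟨ψ, hψ, hψ1⟩ := exists_testFunction_integral_eq_one hab
  have hfin : ENNReal.ofReal (b - a) ^ (1 / 2 : ℝ) ≠ ⊤ :=
    ENNReal.rpow_ne_top_of_nonneg (by norm_num) (by simp)
  choose g hg hgle using fun n : ℕ => (memL2_of_continuous (a := a) (b := b)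
    hy₁).exists_testFunction_near hab (by positivity : (0 : ℝ) < 1 / ((n : ℝ) + 1))
  have hg2 : Tendsto (fun n => eLpNorm (g n - y₁) 2 (volume.restrict (Set.Ioo a b))) atTop (𝓝 0) := by
    refine tendsto_of_tendsto_of_tendsto_of_le_of_le tendsto_const_nhds ?_ (fun _ => zero_le) hgle
    simpa using ENNReal.tendsto_ofReal (tendsto_one_div_add_atTop_nhds_zero_nat (𝕜 := ℝ))
  have hy₁int : ∀ x ∈ Set.Icc a b, ∫ t in a..x, y₁ t = y x := fun x hx => by
    rw [intervalIntegral.integral_eq_sub_of_hasDerivAt (fun t ht => hd t ?_)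
      (hy₁.intervalIntegrable _ _), ha, sub_zero]
    rw [Set.uIcc_of_le hx.1] at ht
    exact ⟨ht.1, ht.2.trans hx.2⟩
  have hI : Tendsto (fun n => ∫ x in a..b, g n x) atTop (𝓝 0) := by
    have h1 := tendsto_integral_of_L1' y₁
      hy₁.aestronglyMeasurable (l := atTop) (F := g) (μ := volume.restrict (Set.Ioo a b))
      (Eventually.of_forall fun n => (memL2_of_continuous (hg n).continuous).integrableOn)
      (tendsto_eLpNorm_one_of_two
        (fun n => ((hg n).continuous.sub hy₁).aestronglyMeasurable) hg2)
    simp only [setIntegral_Ioo_eq hab.le, hy₁int b ⟨hab.le, le_rfl⟩, hb] at h1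
    exact h1
  have hH : ∀ n, IsTestFunction (Set.Ioo a b) (g n - fun x => (∫ t in a..b, g n t) * ψ x) :=
    fun n => (hg n).sub (hψ.const_mul _)
  have hP : ∀ n, _ := fun n => (hH n).primitive hab (by
    simp only [Pi.sub_apply]
    rw [intervalIntegral.integral_sub ((hg n).continuous.intervalIntegrable _ _)
      ((hψ.const_mul _).continuous.intervalIntegrable _ _),
      intervalIntegral.integral_const_mul, hψ1, mul_one, sub_self])
  have hH2 : Tendsto (fun n => eLpNorm ((g n - fun x => (∫ t in a..b, g n t) * ψ x) - y₁) 2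
      (volume.restrict (Set.Ioo a b))) atTop (𝓝 0) := by
    have h1 : Tendsto (fun n => eLpNorm (g n - y₁) 2 (volume.restrict (Set.Ioo a b)) +
        ‖∫ t in a..b, g n t‖ₑ * eLpNorm ψ 2 (volume.restrict (Set.Ioo a b))) atTop (𝓝 0) := by
      have h2 := ENNReal.Tendsto.mul_const (b := eLpNorm ψ 2 (volume.restrict (Set.Ioo a b)))
        hI.enorm (Or.inr (memL2_of_continuous hψ.continuous).2.ne)
      simpa using hg2.add h2
    refine tendsto_of_tendsto_of_tendsto_of_le_of_le tendsto_const_nhds h1 (fun _ => zero_le)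
      (fun n => ?_)
    simp only
    rw [sub_right_comm]
    refine (eLpNorm_sub_le ((hg n).continuous.sub hy₁).aestronglyMeasurable
      (hψ.const_mul _).continuous.aestronglyMeasurable (by norm_num)).trans (le_of_eq ?_)
    congr 1
    exact eLpNorm_const_smul (∫ t in a..b, g n t) ψ 2 _
  refine ⟨fun n x => ∫ t in a..x, (g n - fun x => (∫ t in a..b, g n t) * ψ x) t,
    fun n => (hP n).1, ?_, ?_⟩
  · have hH1 := tendsto_eLpNorm_one_of_two (fun n => ((hH n).continuous.sub
      hy₁).aestronglyMeasurable) hH2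
    have hlim := ENNReal.Tendsto.mul_const (b := ENNReal.ofReal (b - a) ^ (1 / 2 : ℝ)) hH1
      (Or.inr hfin)
    rw [zero_mul] at hlim
    refine tendsto_of_tendsto_of_tendsto_of_le_of_le tendsto_const_nhds hlim (fun _ => zero_le)
      (fun n => ?_)
    set h : ℝ → ℂ := (g n - fun x => (∫ t in a..b, g n t) * ψ x) - y₁ with hh
    have hhc : Continuous h := (hH n).continuous.sub hy₁
    have hL1 : eLpNorm h 1 (volume.restrict (Set.Ioo a b)) =
        ENNReal.ofReal (∫ t in Set.Ioo a b, ‖h t‖) := by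
      rw [eLpNorm_one_eq_lintegral_enorm,
        ← ofReal_integral_norm_eq_lintegral_enorm (memL2_of_continuous hhc).integrableOn]
    have hbd : ∀ᵐ x ∂(volume.restrict (Set.Ioo a b)),
        ‖((fun x => ∫ t in a..x, (g n - fun x => (∫ t in a..b, g n t) * ψ x) t) - y) x‖ ≤
          ∫ t in Set.Ioo a b, ‖h t‖ := by
      filter_upwards [self_mem_ae_restrict measurableSet_Ioo] with x hx
      change ‖(∫ t in a..x, (g n - fun x => (∫ t in a..b, g n t) * ψ x) t) - y x‖ ≤ _
      rw [← hy₁int x (Set.Ioo_subset_Icc_self hx), ← intervalIntegral.integral_sub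
        ((hH n).continuous.intervalIntegrable a x) (hy₁.intervalIntegrable a x)]
      refine (intervalIntegral.norm_integral_le_integral_norm hx.1.le).trans ?_
      rw [intervalIntegral.integral_of_le hx.1.le, integral_Ioc_eq_integral_Ioo]
      exact setIntegral_mono_set (memL2_of_continuous hhc).integrableOn.norm
        (ae_of_all _ fun _ => norm_nonneg _) (Set.Ioo_subset_Ioo_right hx.2.le).eventuallyLE
    simp only
    rw [hL1]
    refine (eLpNorm_le_of_ae_bound hbd).trans (le_of_eq ?_)
    rw [mul_comm, Measure.restrict_apply_univ, Real.volume_Ioo]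
    norm_num
  · refine hH2.congr fun n => ?_
    rw [(hP n).2]

/-- Classical solutions of the Dirichlet problem are eigenfunctions. -/
theorem isDirichletEigenvalue_of_classical (hab : a < b) {V : ℝ → ℝ} (hV : Continuous V)
    {ħ E : ℝ} (hħ : 0 < ħ) {y y₁ : ℝ → ℂ} (hy : Continuous y) (hy₁ : Continuous y₁)
    (hd : ∀ x ∈ Set.Icc a b, HasDerivAt y (y₁ x) x)
    (hd₁ : ∀ x ∈ Set.Icc a b, HasDerivAt y₁ (((V x / ħ ^ 2 - E / ħ ^ 2 : ℝ) : ℂ) * y x) x)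
    (ha : y a = 0) (hb : y b = 0) (hne : ∃ x ∈ Set.Icc a b, y x ≠ 0) :
    IsDirichletEigenvalue ħ V (Set.Ioo a b) E := by
  have hc₂ : Continuous fun x => ((V x / ħ ^ 2 - E / ħ ^ 2 : ℝ) : ℂ) * y x := by fun_prop
  refine ⟨y, y₁, fun x => ((V x / ħ ^ 2 - E / ħ ^ 2 : ℝ) : ℂ) * y x,
    ⟨memL2_of_continuous hy, memL2_of_continuous hy₁, memL2_of_continuous hc₂,
      fun φ hφ => integral_mul_deriv_testFunction hab.le hy₁ hd hφ,
      fun φ hφ => integral_mul_deriv_testFunction hab.le hc₂ hd₁ hφ⟩,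
    isSobolevH10_of_hasDerivAt hab hy hy₁ hd ha hb, fun h0 => ?_, ae_of_all _ fun x => ?_⟩
  · obtain ⟨x, hx, hyx⟩ := hne
    have heq : Set.EqOn y (fun _ => 0) (Set.Ioo a b) :=
      Measure.eqOn_open_of_ae_eq h0 isOpen_Ioo hy.continuousOn continuousOn_const
    rcases eq_or_lt_of_le hx.1 with rfl | h1
    · exact hyx ha
    rcases eq_or_lt_of_le hx.2 with rfl | h2
    · exact hyx hb
    exact hyx (heq ⟨h1, h2⟩)
  · have hħ' : (ħ : ℂ) ≠ 0 := by exact_mod_cast hħ.ne'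
    push_cast
    field_simp
    ring

/-- Uniqueness for the Cauchy problem of a linear second order equation. -/
theorem eq_zero_of_cauchy_data_zero {q : ℝ → ℝ} (hq : ContinuousOn q (Set.Icc a b)) {y y₁ : ℝ → ℂ}
    (hd : ∀ x ∈ Set.Icc a b, HasDerivAt y (y₁ x) x)
    (hd₁ : ∀ x ∈ Set.Icc a b, HasDerivAt y₁ ((q x : ℂ) * y x) x) (ha : y a = 0) (ha₁ : y₁ a = 0) :
    ∀ x ∈ Set.Icc a b, y x = 0 := by
  obtain ⟨K, hK⟩ := isCompact_Icc.exists_bound_of_continuousOn hq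
  have h : ∀ x ∈ Set.Icc a b, HasDerivAt (fun x => (y x, y₁ x)) (y₁ x, (q x : ℂ) * y x) x :=
    fun x hx => (hd x hx).prodMk (hd₁ x hx)
  intro x hx
  have h0 := eq_zero_of_abs_deriv_le_mul_abs_self_of_eq_zero_right (K := max 1 K)
    (f := fun x => (y x, y₁ x)) (fun x hx => (h x hx).continuousAt.continuousWithinAt)
    (fun x hx => (h x ⟨hx.1, hx.2.le⟩).hasDerivWithinAt) (by simp [ha, ha₁]) (fun t ht => ?_) x hx
  · exact (Prod.mk.inj h0).1
  · rw [Prod.norm_mk, Prod.norm_mk]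
    refine max_le ?_ ?_
    · calc ‖y₁ t‖ ≤ 1 * max ‖y t‖ ‖y₁ t‖ := by rw [one_mul]; exact le_max_right _ _
        _ ≤ _ := mul_le_mul_of_nonneg_right (le_max_left _ _) (by positivity)
    · rw [norm_mul, Complex.norm_real]
      exact mul_le_mul ((hK t ⟨ht.1, ht.2.le⟩).trans (le_max_right _ _)) (le_max_left _ _)
        (norm_nonneg _) (by positivity)

section Prufer

variable {W : ℝ → ℝ} {s μ : ℝ} {θ : ℝ → ℝ}

/-- The solution of the equation with a given Prüfer angle. -/
theorem IsPruferAngle.exists_solution (hW : Continuous W) (hs : 0 < s)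
    (hθ : IsPruferAngle W s μ a b θ) :
    ∃ R : ℝ → ℝ, Continuous R ∧ (∀ x, 0 < R x) ∧
      (∀ x ∈ Set.Icc a b,
        HasDerivAt (fun x => R x * Real.sin (θ x)) (s * R x * Real.cos (θ x)) x) ∧
      ∀ x ∈ Set.Icc a b, HasDerivAt (fun x => s * R x * Real.cos (θ x))
        ((W x - μ) * (R x * Real.sin (θ x))) x := by
  have hθc := hθ.continuous
  -- `-f` is the logarithmic derivative of the amplitude, forced by `(R sin θ)' = s R cos θ`.
  set f : ℝ → ℝ := fun x => ((μ - W x) / s - s) * Real.sin (θ x) * Real.cos (θ x) with hf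
  have hfc : Continuous f := by fun_prop
  set R : ℝ → ℝ := fun x => Real.exp (-∫ t in a..x, f t) with hR
  have hRd : ∀ x, HasDerivAt R (R x * -f x) x := fun x =>
    (hfc.integral_hasStrictDerivAt a x).hasDerivAt.neg.exp
  refine ⟨R, continuous_iff_continuousAt.2 fun x => (hRd x).continuousAt,
    fun x => Real.exp_pos _, fun x hx => ?_, fun x hx => ?_⟩
  · refine ((hRd x).mul (hθ.hasDerivAt x hx).sin).congr_deriv ?_
    simp only [hf]
    ring
  · refine (((hRd x).const_mul s).mul (hθ.hasDerivAt x hx).cos).congr_deriv ?_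
    simp only [hf]
    have h2 := Real.sin_sq_add_cos_sq (θ x)
    field_simp
    linear_combination (-R x * Real.sin (θ x) * (μ - W x - s ^ 2)) * h2

/-- `E` is a Dirichlet eigenvalue iff the Prüfer angle at the right end is a multiple of `π`. -/
theorem isDirichletEigenvalue_iff_sin_eq_zero (hab : a < b) {V : ℝ → ℝ} (hV : Continuous V)
    {ħ E : ℝ} (hħ : 0 < ħ) (hs : 0 < s)
    (hθ : IsPruferAngle (fun x => V x / ħ ^ 2) s (E / ħ ^ 2) a b θ) :
    IsDirichletEigenvalue ħ V (Set.Ioo a b) E ↔ Real.sin (θ b) = 0 := by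
  have hWc : Continuous fun x => V x / ħ ^ 2 := by fun_prop
  have hθc := hθ.continuous
  obtain ⟨R, hRc, hR0, hRd, hRd₁⟩ := hθ.exists_solution hWc hs
  have ha' : a ∈ Set.Icc a b := ⟨le_rfl, hab.le⟩
  have hb' : b ∈ Set.Icc a b := ⟨hab.le, le_rfl⟩
  have hza : ((R a * Real.sin (θ a) : ℝ) : ℂ) = 0 := by simp [hθ.init]
  have hd : ∀ x ∈ Set.Icc a b, HasDerivAt (fun x => ((R x * Real.sin (θ x) : ℝ) : ℂ))
      ((s * R x * Real.cos (θ x) : ℝ) : ℂ) x := fun x hx => (hRd x hx).ofReal_comp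
  have hd₁ : ∀ x ∈ Set.Icc a b, HasDerivAt (fun x => ((s * R x * Real.cos (θ x) : ℝ) : ℂ))
      (((V x / ħ ^ 2 - E / ħ ^ 2 : ℝ) : ℂ) * ((R x * Real.sin (θ x) : ℝ) : ℂ)) x := fun x hx => by
    have := (hRd₁ x hx).ofReal_comp
    rwa [Complex.ofReal_mul] at this
  constructor
  · intro hE
    obtain ⟨y, y₁, hy, hy₁, hya, hyb, x₁, hx₁, hyx₁⟩ := hE.exists_classical hab hV hħ
    have hsa : s * R a ≠ 0 := (mul_pos hs (hR0 a)).ne'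
    -- The multiple matching the slopes at `a`; the difference of the two solutions then has zero
    -- Cauchy data.
    set c : ℂ := y₁ a / ((s * R a : ℝ) : ℂ) with hc
    have hz := eq_zero_of_cauchy_data_zero (q := fun x => V x / ħ ^ 2 - E / ħ ^ 2)
      (y := fun x => y x - c * ((R x * Real.sin (θ x) : ℝ) : ℂ))
      (y₁ := fun x => y₁ x - c * ((s * R x * Real.cos (θ x) : ℝ) : ℂ)) (a := a) (b := b)
      (by fun_prop) (fun x hx => (hy x hx).sub ((hd x hx).const_mul c))
      (fun x hx => ((hy₁ x hx).sub ((hd₁ x hx).const_mul c)).congr_deriv (by ring))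
      (by simp [hya, hθ.init]) (by
        have hsa' : ((s * R a : ℝ) : ℂ) ≠ 0 := by exact_mod_cast hsa
        simp only [hθ.init, Real.cos_zero, mul_one]
        rw [hc, div_mul_cancel₀ _ hsa', sub_self])
    have hc0 : c ≠ 0 := by
      intro hc0
      have := hz x₁ hx₁
      simp only [hc0, zero_mul, sub_zero] at this
      exact hyx₁ this
    have hb0 := hz b hb'
    simp only [hyb, zero_sub, neg_eq_zero, mul_eq_zero, hc0, false_or, Complex.ofReal_eq_zero,
      (hR0 b).ne'] at hb0
    exact hb0
  · intro hb0
    refine isDirichletEigenvalue_of_classical hab hV hħ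
      (y := fun x => ((R x * Real.sin (θ x) : ℝ) : ℂ))
      (y₁ := fun x => ((s * R x * Real.cos (θ x) : ℝ) : ℂ)) (by fun_prop) (by fun_prop)
      hd hd₁ hza (by simp [hb0]) ?_
    -- If the solution vanished identically, `sin θ` and `cos θ` would both vanish at the midpoint.
    by_contra! h0
    have h1 := (hd ((a + b) / 2) ⟨by linarith, by linarith⟩).unique
      ((hasDerivAt_const _ (0 : ℂ)).congr_of_eventuallyEq
        (Filter.eventually_of_mem (Icc_mem_nhds (by linarith) (by linarith)) h0))
    have h2 := h0 ((a + b) / 2) ⟨by linarith, by linarith⟩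
    have hR1 := (hR0 ((a + b) / 2)).ne'
    simp only [Complex.ofReal_eq_zero, mul_eq_zero, hs.ne', hR1, false_or] at h1 h2
    have h3 := Real.sin_sq_add_cos_sq (θ ((a + b) / 2))
    rw [h1, h2] at h3
    norm_num at h3

end Prufer

end

/-! ### Eigenvalue counting, quantization and asymptotics -/

section

variable {a b : ℝ}

/-- Oscillation theorem: the Prüfer angle at an eigenvalue counts the eigenvalues below it. -/
theorem exists_isQuantumNumber (hab : a < b) {V : ℝ → ℝ} (hV : Continuous V) {ħ E s : ℝ}
    (hħ : 0 < ħ) (hs : 0 < s) (hE : IsDirichletEigenvalue ħ V (Set.Ioo a b) E) :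
    ∃ (m : ℕ) (θ : ℝ → ℝ), IsQuantumNumber ħ V (Set.Ioo a b) E m ∧
      IsPruferAngle (fun x => V x / ħ ^ 2) s (E / ħ ^ 2) a b θ ∧
      θ b = ((m : ℝ) + 1) * Real.pi := by
  have hWc : Continuous fun x => V x / ħ ^ 2 := by fun_prop
  choose Φ hΦ using fun μ => exists_isPruferAngle (a := a) (b := b) hWc s μ hab.le
  have hħ2 : 0 < ħ ^ 2 := by positivity
  set F : ℝ → ℝ := fun E' => Φ (E' / ħ ^ 2) b with hF
  have hmono : StrictMono F := fun E₁ E₂ h12 =>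
    (hΦ _).right_lt_right hWc hs hab (hΦ _) (by gcongr)
  have hcont : Continuous F :=
    (continuous_pruferAngle_right hWc hs hab.le hΦ).comp (continuous_id.div_const _)
  have hpos : ∀ E', 0 < F E' := fun E' =>
    have h := (hΦ (E' / ħ ^ 2)).right_pos hWc hs hab
    h
  have hiff : ∀ E', IsDirichletEigenvalue ħ V (Set.Ioo a b) E' ↔ Real.sin (F E') = 0 := fun E' =>
    isDirichletEigenvalue_iff_sin_eq_zero hab hV hħ hs (hΦ _)
  obtain ⟨M, hM⟩ := (isCompact_Icc (a := a) (b := b)).exists_bound_of_continuousOn hV.continuousOn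
  have hlow : F (-M) ≤ Real.pi / 2 := by
    have h := (hΦ (-M / ħ ^ 2)).right_le_pi_div_two hs hab.le fun x hx => by
      have := (abs_le.1 (hM x hx)).1
      gcongr
    exact h
  have hpi := Real.pi_pos
  -- Positivity of the angle excludes the multiple `0`: the ground state has angle `π`, whence `k +
  -- 1`.
  have hnat : ∀ E', Real.sin (F E') = 0 → ∃ k : ℕ, F E' = ((k : ℝ) + 1) * Real.pi := by
    intro E' h
    obtain ⟨n, hn⟩ := Real.sin_eq_zero_iff.1 h
    have hn0 : (0 : ℝ) < n := by
      have := hpos E'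
      rw [← hn] at this
      exact pos_of_mul_pos_left this hpi.le
    have hn1 : 0 < n := by exact_mod_cast hn0
    obtain ⟨k, hk⟩ := Int.eq_ofNat_of_zero_le (show 0 ≤ n - 1 by omega)
    refine ⟨k, ?_⟩
    rw [← hn, show n = (k : ℤ) + 1 by omega]
    push_cast
    rfl
  obtain ⟨m, hm⟩ := hnat E ((hiff E).1 hE)
  refine ⟨m, Φ (E / ħ ^ 2), ?_, hΦ _, hm⟩
  -- `F` maps the eigenvalues below `E` bijectively onto `π, 2π, …, mπ`. Each value is attained by
  -- the intermediate value theorem, as `F (-M) ≤ π/2 < π`.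
  have himage : F '' {E' | IsDirichletEigenvalue ħ V (Set.Ioo a b) E' ∧ E' < E} =
      (fun k : ℕ => ((k : ℝ) + 1) * Real.pi) '' (Finset.range m : Set ℕ) := by
    ext y
    constructor
    · rintro ⟨E', ⟨h1, h2⟩, rfl⟩
      obtain ⟨k, hk⟩ := hnat E' ((hiff E').1 h1)
      refine ⟨k, ?_, hk.symm⟩
      have h3 := hmono h2
      rw [hk, hm] at h3
      have h4 := lt_of_mul_lt_mul_right h3 hpi.le
      simpa using h4
    · rintro ⟨k, hk, rfl⟩
      have hkm : (k : ℝ) + 1 ≤ m := by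
        have : k < m := by simpa using hk
        exact_mod_cast this
      have hk0 : (0 : ℝ) ≤ k := Nat.cast_nonneg k
      have h1 : ((k : ℝ) + 1) * Real.pi < F E := by
        rw [hm]
        nlinarith
      have h2 : F (-M) < ((k : ℝ) + 1) * Real.pi := by nlinarith
      have h3 : -M < E := hmono.lt_iff_lt.1 (h2.trans h1)
      obtain ⟨E', hE', hFE'⟩ := intermediate_value_Icc h3.le hcont.continuousOn ⟨h2.le, h1.le⟩
      refine ⟨E', ⟨(hiff E').2 ?_, ?_⟩, hFE'⟩
      · rw [hFE']
        exact_mod_cast Real.sin_nat_mul_pi (k + 1)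
      · rw [← hmono.lt_iff_lt, hFE']
        exact h1
  have hinj : Function.Injective fun k : ℕ => ((k : ℝ) + 1) * Real.pi := fun k₁ k₂ h => by
    have := mul_right_cancel₀ hpi.ne' h
    exact_mod_cast add_right_cancel this
  unfold IsQuantumNumber
  rw [← hmono.injective.encard_image, himage, hinj.encard_image,
    Set.encard_coe_eq_coe_finsetCard, Finset.card_range]

/-- Quantization with the constant momentum of the asymptotic potential. -/
theorem exists_isQuantumNumber_abs_sub_le (hab : a < b) {V : ℝ → ℝ} (hV : Continuous V)
    {ħ E v k : ℝ} (hħ : 0 < ħ) (hk : 0 < k) (hkE : E - v = k ^ 2)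
    (hE : IsDirichletEigenvalue ħ V (Set.Ioo a b) E) :
    ∃ m : ℕ, IsQuantumNumber ħ V (Set.Ioo a b) E m ∧
      |((m : ℝ) + 1) * Real.pi * ħ - k * (b - a)| ≤ (∫ x in a..b, |V x - v|) / k := by
  have hs : 0 < k / ħ := by positivity
  obtain ⟨m, θ, hm, hθ, hθb⟩ := exists_isQuantumNumber hab hV hħ hs hE
  refine ⟨m, hm, ?_⟩
  have h := hθ.abs_right_sub_free_le (by fun_prop) hs hab.le (w := v / ħ ^ 2)
    (by rw [← sub_div, hkE, div_pow])
  have h1 : ∀ x, |V x / ħ ^ 2 - v / ħ ^ 2| = |V x - v| / ħ ^ 2 := fun x => by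
    rw [← sub_div, abs_div, abs_of_pos (by positivity : (0 : ℝ) < ħ ^ 2)]
  simp only [h1] at h
  rw [intervalIntegral.integral_div, hθb] at h
  have h2 := mul_le_mul_of_nonneg_left h hħ.le
  rw [← abs_of_pos hħ, ← abs_mul, abs_of_pos hħ] at h2
  have h3 : ħ * (((m : ℝ) + 1) * Real.pi - k / ħ * (b - a)) =
      ((m : ℝ) + 1) * Real.pi * ħ - k * (b - a) := by
    field_simp
  have h4 : ħ * ((∫ x in a..b, |V x - v|) / ħ ^ 2 / (k / ħ)) = (∫ x in a..b, |V x - v|) / k := by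
    field_simp
  rwa [h3, h4] at h2

/-- Integrals of functions with power decay. -/
theorem exists_integral_abs_le_rpow {f : ℝ → ℝ} (hf : Continuous f) {ε κ : ℝ}
    (hfO : f =O[atTop] fun x : ℝ => |x| ^ (-ε)) (hκε : κ ≤ ε) (hκ1 : κ ≤ 1)
    (hε1 : ε = 1 → κ < 1) (a : ℝ) :
    ∃ D > 0, ∃ ℓ₁ : ℝ, ∀ ℓ > ℓ₁, ∫ x in a..ℓ, |f x| ≤ D * ℓ ^ (1 - κ) := by
  -- The exponent used for integration must avoid the logarithm at `β = 1`. For `κ < 1` take `β =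
  -- κ`; for `κ = 1` necessarily `ε > 1`, and `β = ε` gives a bounded integral.
  obtain ⟨β, hκβ, hβε, hβ1, hβ⟩ : ∃ β, κ ≤ β ∧ β ≤ ε ∧ β ≠ 1 ∧ (β < 1 → β = κ) := by
    rcases lt_or_eq_of_le hκ1 with h | h
    · exact ⟨κ, le_rfl, hκε, h.ne, fun _ => rfl⟩
    · exact ⟨ε, hκε, le_rfl, fun h' => (hε1 h').ne h, fun h' => by linarith⟩
  obtain ⟨C, hC0, hC⟩ := hfO.exists_pos
  obtain ⟨x₀, hx₀⟩ := eventually_atTop.1 hC.bound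
  set x₁ := max (max x₀ a) 1 with hx₁
  have hx₁1 : 1 ≤ x₁ := le_max_right _ _
  have hx₁a : a ≤ x₁ := (le_max_right _ _).trans (le_max_left _ _)
  have hx₁0 : x₀ ≤ x₁ := (le_max_left _ _).trans (le_max_left _ _)
  set I := ∫ x in a..x₁, |f x| with hI
  have hI0 : 0 ≤ I := intervalIntegral.integral_nonneg hx₁a fun _ _ => abs_nonneg _
  have hβ' : 0 < |1 - β| := abs_pos.2 (sub_ne_zero.2 hβ1.symm)
  refine ⟨I + C / |1 - β|, by positivity, x₁, fun ℓ hℓ => ?_⟩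
  have hℓ1 : 1 ≤ ℓ := hx₁1.trans hℓ.le
  have hpow1 : 1 ≤ ℓ ^ (1 - κ) := Real.one_le_rpow hℓ1 (by linarith)
  have hnot : (0 : ℝ) ∉ Set.uIcc x₁ ℓ := by
    rw [Set.uIcc_of_le hℓ.le]
    exact fun h => by linarith [h.1]
  have hpc : IntervalIntegrable (fun x : ℝ => C * x ^ (-β)) volume x₁ ℓ :=
    (intervalIntegral.intervalIntegrable_rpow (Or.inr hnot)).const_mul C
  have htail : ∫ x in x₁..ℓ, |f x| ≤ C / |1 - β| * ℓ ^ (1 - κ) := by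
    calc ∫ x in x₁..ℓ, |f x| ≤ ∫ x in x₁..ℓ, C * x ^ (-β) := by
          refine intervalIntegral.integral_mono_on hℓ.le (hf.abs.intervalIntegrable _ _) hpc
            fun x hx => ?_
          have h1 := hx₀ x (hx₁0.trans hx.1)
          have hx1 : 1 ≤ x := hx₁1.trans hx.1
          have hx0 : 0 < x := by linarith
          rw [abs_of_pos hx0, Real.norm_eq_abs, Real.norm_eq_abs,
            abs_of_nonneg (Real.rpow_nonneg hx0.le _)] at h1
          refine h1.trans (mul_le_mul_of_nonneg_left ?_ hC0.le)
          exact Real.rpow_le_rpow_of_exponent_le hx1 (by linarith)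
      _ = C * ((ℓ ^ (1 - β) - x₁ ^ (1 - β)) / (1 - β)) := by
          rw [intervalIntegral.integral_const_mul, integral_rpow
            (Or.inr ⟨fun h => hβ1 (by linarith), hnot⟩), neg_add_eq_sub]
      _ ≤ C * (ℓ ^ (1 - κ) / |1 - β|) := by
          refine mul_le_mul_of_nonneg_left ?_ hC0.le
          rcases lt_or_gt_of_ne hβ1 with h | h
          · rw [hβ h, abs_of_pos (by linarith [hβ h])]
            have : 0 ≤ x₁ ^ (1 - κ) := by positivity
            have h' : 0 < 1 - κ := by linarith [hβ h]
            gcongr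
            linarith
          · rw [abs_of_neg (by linarith), ← neg_div_neg_eq]
            have h2 : x₁ ^ (1 - β) ≤ 1 := Real.rpow_le_one_of_one_le_of_nonpos hx₁1 (by linarith)
            have h3 : 0 ≤ ℓ ^ (1 - β) := by positivity
            have h' : 0 < -(1 - β) := by linarith
            gcongr
            linarith
      _ = C / |1 - β| * ℓ ^ (1 - κ) := by ring
  rw [← intervalIntegral.integral_add_adjacent_intervals (hf.abs.intervalIntegrable a x₁)
    (hf.abs.intervalIntegrable x₁ ℓ), add_mul]
  exact add_le_add (le_mul_of_one_le_right hI0 hpow1) htail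

/-- Here `q ≥ k/2` and `q ≥ k₀/2`, so `(k + q)/q² ≤ 3/q ≤ 6/k₀`. -/
theorem abs_sq_div_sq_sub_one_le {k q k₀ d : ℝ} (hk₀ : 0 < k₀) (hk : k₀ ≤ k) (hqk : |q - k| ≤ d)
    (hd : d ≤ k₀ / 2) : 0 < q ∧ |k ^ 2 / q ^ 2 - 1| ≤ d * (6 / k₀) := by
  obtain ⟨h1, h2⟩ := abs_le.1 hqk
  have hq : 0 < q := by linarith
  refine ⟨hq, ?_⟩
  have h3 : k ^ 2 / q ^ 2 - 1 = (k - q) * ((k + q) / q ^ 2) := by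
    field_simp
    ring
  rw [h3, abs_mul, abs_sub_comm k q]
  have h4 : 0 ≤ (k + q) / q ^ 2 := div_nonneg (by linarith) (by positivity)
  rw [abs_of_nonneg h4]
  refine mul_le_mul hqk ?_ h4 ((abs_nonneg _).trans hqk)
  rw [div_le_div_iff₀ (by positivity) hk₀]
  nlinarith

/-- The eigenvalue asymptotics on intervals of length `ℓ - ω` on which the potential is `v` up to
an integral error `O(ℓ ^ (1 - κ))`. -/
theorem exists_eigenvalue_asymptotics {V : ℝ → ℝ} (hV : Continuous V) {v v₀ ω κ D ℓ₁ : ℝ}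
    (hv : v < v₀) (hω : 0 < ω) (hκ : 0 < κ) (hκ1 : κ ≤ 1) (hD : 0 < D) (a b : ℝ → ℝ)
    (hlen : ∀ ℓ, b ℓ - a ℓ = ℓ - ω)
    (hint : ∀ ℓ > ℓ₁, ∫ x in a ℓ..b ℓ, |V x - v| ≤ D * ℓ ^ (1 - κ)) :
    ∃ ℓ₀ > 0, ∃ C > 0, ∀ ħ : ℝ, 0 < ħ → ħ < 1 → ∀ ℓ : ℝ, ℓ₀ < ℓ → ∀ E ∈ Set.Ioo v₀ (v₀ + 1),
      IsDirichletEigenvalue ħ V (Set.Ioo (a ℓ) (b ℓ)) E →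
        ∃ m : ℕ, IsQuantumNumber ħ V (Set.Ioo (a ℓ) (b ℓ)) E m ∧
          ∃ r : ℝ, |r| ≤ C * (ħ + ℓ ^ (-κ)) ∧
            E = v + (((m : ℝ) + 3 / 4) * Real.pi * ħ / ℓ) ^ 2 * (1 + r) := by
  set k₀ := Real.sqrt (v₀ - v) with hk₀
  set k₁ := Real.sqrt (v₀ + 1 - v) with hk₁
  have hk₀0 : 0 < k₀ := Real.sqrt_pos.2 (by linarith)
  have hk₁0 : 0 < k₁ := Real.sqrt_pos.2 (by linarith)
  have hpi := Real.pi_pos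
  -- The three errors in `qℓ - kℓ`: the missing length `ω`, the integral of `|V - v|`, and the shift
  -- from `m + 1` to `m + 3/4`. Each is at most its constant times `ℓ^(1-κ)`, using `ℓ^(1-κ) ≥ 1`
  -- and `ħ < 1`.
  set B := k₁ * ω + D / k₀ + Real.pi with hB
  have hB0 : 0 < B := by positivity
  have htend : Tendsto (fun ℓ : ℝ => B * ℓ ^ (-κ)) atTop (𝓝 0) := by
    simpa using (tendsto_rpow_neg_atTop hκ).const_mul B
  obtain ⟨ℓ₂, hℓ₂⟩ := eventually_atTop.1 (htend.eventually (ge_mem_nhds (half_pos hk₀0)))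
  refine ⟨max (max ℓ₁ ℓ₂) (max ω 1), by positivity, B * (6 / k₀), by positivity,
    fun ħ hħ hħ1 ℓ hℓ E hE heig => ?_⟩
  obtain ⟨⟨hℓ1, hℓ2⟩, hℓω, hℓone⟩ : (ℓ₁ < ℓ ∧ ℓ₂ < ℓ) ∧ ω < ℓ ∧ 1 < ℓ := by
    simpa only [max_lt_iff] using hℓ
  have hℓ0 : 0 < ℓ := by linarith
  set k := Real.sqrt (E - v) with hk
  have hk0 : k₀ ≤ k := Real.sqrt_le_sqrt (by linarith [hE.1])
  have hk1 : k ≤ k₁ := Real.sqrt_le_sqrt (by linarith [hE.2])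
  have hkE : E - v = k ^ 2 := (Real.sq_sqrt (by linarith [hE.1])).symm
  have hkpos : 0 < k := hk₀0.trans_le hk0
  obtain ⟨m, hm, hmk⟩ := exists_isQuantumNumber_abs_sub_le (by linarith [hlen ℓ]) hV hħ hkpos hkE
    heig
  refine ⟨m, hm, ?_⟩
  set q := ((m : ℝ) + 3 / 4) * Real.pi * ħ / ℓ with hq
  have hpow : ℓ ^ (1 - κ) = ℓ * ℓ ^ (-κ) := by
    rw [sub_eq_add_neg, Real.rpow_add hℓ0, Real.rpow_one]
  have hp0 : 0 < ℓ ^ (-κ) := by positivity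
  have hinv : 1 ≤ ℓ * ℓ ^ (-κ) := by
    rw [← hpow]
    exact Real.one_le_rpow hℓone.le (by linarith)
  have hmk' : |((m : ℝ) + 1) * Real.pi * ħ - k * (ℓ - ω)| ≤ D / k₀ * (ℓ * ℓ ^ (-κ)) := by
    rw [← hlen ℓ]
    refine hmk.trans ?_
    rw [← hpow, div_mul_eq_mul_div]
    exact div_le_div₀ (by positivity) (hint ℓ hℓ1) hk₀0 hk0
  have hqk : |q - k| ≤ B * ℓ ^ (-κ) := by
    have h1 : q - k = (((m : ℝ) + 1) * Real.pi * ħ - k * (ℓ - ω) - k * ω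
        - Real.pi * ħ / 4) / ℓ := by
      rw [hq]
      field_simp
      ring
    rw [h1, abs_div, abs_of_pos hℓ0, div_le_iff₀ hℓ0]
    have h2 : k * ω ≤ k₁ * ω * (ℓ * ℓ ^ (-κ)) :=
      (mul_le_mul_of_nonneg_right hk1 hω.le).trans (le_mul_of_one_le_right (by positivity) hinv)
    have h3 : Real.pi * ħ / 4 ≤ Real.pi * (ℓ * ℓ ^ (-κ)) := by nlinarith
    have h4 : 0 ≤ k * ω := by positivity
    have h5 : 0 ≤ Real.pi * ħ / 4 := by positivity
    obtain ⟨h6, h7⟩ := abs_le.1 hmk'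
    have h8 : B * ℓ ^ (-κ) * ℓ = k₁ * ω * (ℓ * ℓ ^ (-κ)) + D / k₀ * (ℓ * ℓ ^ (-κ)) +
        Real.pi * (ℓ * ℓ ^ (-κ)) := by
      rw [hB]; ring
    have h9 : 0 ≤ k₁ * ω * (ℓ * ℓ ^ (-κ)) := by positivity
    have h10 : 0 ≤ Real.pi * (ℓ * ℓ ^ (-κ)) := by positivity
    rw [h8, abs_le]
    constructor <;> linarith
  obtain ⟨hq0, hr⟩ := abs_sq_div_sq_sub_one_le hk₀0 hk0 hqk (hℓ₂ ℓ hℓ2.le)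
  refine ⟨k ^ 2 / q ^ 2 - 1, hr.trans ?_, ?_⟩
  -- The error is already `O(ℓ^(-κ))`; the term in `ħ` only enlarges the bound.
  · have : 0 ≤ B * (6 / k₀) * ħ := by positivity
    linarith
  · rw [add_sub_cancel, mul_div_cancel₀ _ (by positivity), ← hkE]
    ring

end

end BoxResonance

theorem mainTheorem3
    (V : ℝ → ℝ) (x₀ v₀ ωm ωp vm vp ε κ : ℝ)
    (h1 : BoxResonance.HypothesisH1 V x₀ v₀)
    (hΩ : BoxResonance.IsInteriorRegion V x₀ v₀ ωm ωp)
    (h4 : BoxResonance.HypothesisH4 V v₀ ωm ωp vm vp ε)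
    (hκ : 0 < κ) (hκε : κ ≤ ε) (hκ1 : κ ≤ 1) (hε1 : ε = 1 → κ < 1) :
    ∃ δ > 0, ∃ ħ₀ > 0, ∃ ℓ₀ > 0, ∃ C > 0,
      ∀ ħ : ℝ, 0 < ħ → ħ < ħ₀ → ∀ ℓ : ℝ, ℓ₀ < ℓ → ∀ E ∈ Set.Ioo v₀ (v₀ + δ),
        (BoxResonance.IsDirichletEigenvalue ħ V (BoxResonance.exteriorMinus ωm ℓ) E →
          ∃ m : ℕ, BoxResonance.IsQuantumNumber ħ V (BoxResonance.exteriorMinus ωm ℓ) E m ∧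
            ∃ r : ℝ, |r| ≤ C * (ħ + ℓ ^ (-κ)) ∧
              E = vm + (((m : ℝ) + 3 / 4) * Real.pi * ħ / ℓ) ^ 2 * (1 + r)) ∧
        (BoxResonance.IsDirichletEigenvalue ħ V (BoxResonance.exteriorPlus ωp ℓ) E →
          ∃ m : ℕ, BoxResonance.IsQuantumNumber ħ V (BoxResonance.exteriorPlus ωp ℓ) E m ∧
            ∃ r : ℝ, |r| ≤ C * (ħ + ℓ ^ (-κ)) ∧
              E = vp + (((m : ℝ) + 3 / 4) * Real.pi * ħ / ℓ) ^ 2 * (1 + r)) := by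
  have hV : Continuous V := h1.contDiff.continuous
  -- The reflection `x ↦ -x` reduces the decay at `-∞` to the case of `+∞`.
  have hO : (fun x : ℝ => V (-x) - vm) =O[atTop] fun x : ℝ => |x| ^ (-ε) := by
    simpa [Function.comp_def] using h4.decay_bot.comp_tendsto tendsto_neg_atTop_atBot
  obtain ⟨Dm, hDm, ℓm, hm⟩ := BoxResonance.exists_integral_abs_le_rpow (by fun_prop) hO hκε hκ1
    hε1 (-ωm)
  obtain ⟨Dp, hDp, ℓp, hp⟩ := BoxResonance.exists_integral_abs_le_rpow (by fun_prop) h4.decay_top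
    hκε hκ1 hε1 ωp
  obtain ⟨ℓ₁, hℓ₁, C₁, hC₁, H₁⟩ := BoxResonance.exists_eigenvalue_asymptotics hV h4.vm_lt
    (neg_pos.2 hΩ.neg) hκ hκ1 hDm (fun ℓ => -ℓ) (fun _ => ωm) (fun ℓ => by ring) (fun ℓ hℓ => by
      have h := hm ℓ hℓ
      rwa [intervalIntegral.integral_comp_neg (fun x => |V x - vm|), neg_neg] at h)
  obtain ⟨ℓ₂, hℓ₂, C₂, hC₂, H₂⟩ := BoxResonance.exists_eigenvalue_asymptotics hV h4.vp_lt
    hΩ.pos hκ hκ1 hDp (fun _ => ωp) (fun ℓ => ℓ) (fun ℓ => rfl) hp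
  refine ⟨1, one_pos, 1, one_pos, max ℓ₁ ℓ₂, lt_max_of_lt_left hℓ₁, max C₁ C₂,
    lt_max_of_lt_left hC₁, fun ħ hħ hħ1 ℓ hℓ E hE => ⟨fun heig => ?_, fun heig => ?_⟩⟩
  all_goals
    have hℓ0 : 0 < ℓ := hℓ₁.trans ((le_max_left _ _).trans_lt hℓ)
    have hpos : 0 ≤ ħ + ℓ ^ (-κ) := by positivity
  · obtain ⟨m, hm, r, hr, hEr⟩ := H₁ ħ hħ hħ1 ℓ ((le_max_left _ _).trans_lt hℓ) E hE heig
    exact ⟨m, hm, r, hr.trans (mul_le_mul_of_nonneg_right (le_max_left _ _) hpos), hEr⟩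
  · obtain ⟨m, hm, r, hr, hEr⟩ := H₂ ħ hħ hħ1 ℓ ((le_max_right _ _).trans_lt hℓ) E hE heig
    exact ⟨m, hm, r, hr.trans (mul_le_mul_of_nonneg_right (le_max_right _ _) hpos), hEr⟩
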